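/- Let $K$ be an algebraically closed field of characteristic $p>0$, let $d\ge 2$, and let $(X,D)$ be a toric pair of dimension $d-1$ over $K$: $X=X(\Delta)$ is the toric variety over $K$ of a complete fan $\Delta$ of strongly convex rational polyhedral cones in $N_{\mathbb R}=\mathbb R^{d-1}$, $N=\mathbb Z^{d-1}$, and $D=\sum_i a_iD_i$ $(a_i\in\mathbb Z)$ is a very ample $T$-Cartier divisor on $X$, where $D_i$ is the torus-invariant prime divisor of the ray of $\Delta$ with primitive generator $v_i$. Let $M=\mathbb Z^{d-1}$ be the dual lattice, and let $P_D=\{u\in M_{\mathbb R}=\mathbb R^{d-1}\mid \langle u,v_i\rangle\ge -a_i\text{ for all }i\}$. Write $P_D\cap M=\{u_1,\dots,u_r\}$, and let $K[S]=K[\chi^{(u_1,1)},\dots,\chi^{(u_r,1)}]$ be the homogeneous coordinate ring of $X$ in $\mathbb P^{r-1}$, graded by $\deg\chi^{(u_j,1)}=1$, with graded maximal ideal $\mathbf m$. For $q=p^n$ let $\mathbf m^{[q]}$ be the ideal generated by the $q$-th powers of the elements of $\mathbf m$. The Hilbert–Kunz density function of $(X,D)$ is $$HKd(X,D)(\lambda)=\lim_{n\to\infty}\frac{1}{q^{d-1}}\,\ell\!\left(\frac{K[S]}{\mathbf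 m^{[q]}}\right)_{\lfloor q\lambda\rfloor},\qquad q=p^n,\ \lambda\ge 0,$$ where the subscript denotes the graded component and $\ell$ its length, that is, its dimension over $K$. Let $C_D\subseteq M_{\mathbb R}\times\mathbb R=\mathbb R^d$ be the convex cone spanned by $P_D\times\{1\}$, let $$\mathcal P_D=\{x\in C_D\mid x\notin (u,1)+C_D\ \text{for every}\ u\in P_D\cap M\},$$ and let $\overline{\mathcal P}_D$ be its closure. Denote by $z$ the last coordinate of $\mathbb R^d$. Then, for every $\lambda\ge 0$, the limit defining $HKd(X,D)(\lambda)$ exists, the slice $\overline{\mathcal P}_D\cap\{z=\lambda\}$ has finite $(d-1)$-dimensional volume, and $$HKd(X,D)(\lambda)=\mathrm{Vol}_{d-1}\bigl(\overline{\mathcal P}_D\cap\{z=\lambda\}\bigr).$$ -/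

import Mathlib

open CategoryTheory CategoryTheory.Limits AlgebraicGeometry

universe u

namespace Toric

/-! ### Cones and fans in `N_ℝ = ℝ ^ n`, where `N = ℤ ^ n` and `M = ℤ ^ n` with the standard pairing -/

/-- A lattice vector, seen as a real vector. -/
def latVec {n : ℕ} (v : Fin n → ℤ) : Fin n → ℝ := fun i => (v i : ℝ)

lemma latVec_add {n : ℕ} (v w : Fin n → ℤ) : latVec (v + w) = latVec v + latVec w := by
  ext i; simp [latVec]

lemma latVec_zero {n : ℕ} : latVec (0 : Fin n → ℤ) = 0 := by
  ext i; simp [latVec]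

lemma latVec_nsmul {n : ℕ} (k : ℕ) (v : Fin n → ℤ) : latVec (k • v) = (k : ℝ) • latVec v := by
  ext i; simp [latVec]

/-- The monoid `S_σ = σ^∨ ∩ M` of lattice points of the dual cone. -/
def dualMonoid {n : ℕ} (σ : PointedCone ℝ (Fin n → ℝ)) : AddSubmonoid (Fin n → ℤ) where
  carrier := {m | ∀ x ∈ σ, 0 ≤ latVec m ⬝ᵥ x}
  zero_mem' := fun x _ => by simp [latVec_zero]
  add_mem' := fun {a b} ha hb x hx => by
    rw [latVec_add, add_dotProduct]; exact add_nonneg (ha x hx) (hb x hx)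

lemma mem_dualMonoid {n : ℕ} {σ : PointedCone ℝ (Fin n → ℝ)} {m : Fin n → ℤ} :
    m ∈ dualMonoid σ ↔ ∀ x ∈ σ, 0 ≤ latVec m ⬝ᵥ x := Iff.rfl

lemma dualMonoid_anti {n : ℕ} {τ σ : PointedCone ℝ (Fin n → ℝ)} (h : τ ≤ σ) :
    dualMonoid σ ≤ dualMonoid τ := fun _ hm x hx => hm x (h hx)

/-- `τ` is a face of the cone `σ`: the intersection of `σ` with a supporting hyperplane `m ^ ⊥`,
`m ∈ σ^∨`.  (For the rational cones of a fan every face is cut out by a lattice point `m`.) -/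
def IsFace {n : ℕ} (τ σ : PointedCone ℝ (Fin n → ℝ)) : Prop :=
  ∃ m ∈ dualMonoid σ, ∀ x, x ∈ τ ↔ x ∈ σ ∧ latVec m ⬝ᵥ x = 0

/-- A (nonempty) fan in `ℝ ^ n`: a finite collection of strongly convex rational polyhedral cones,
closed under taking faces, in which any two cones meet in a common face. -/
structure Fan (n : ℕ) where
  cones : Set (PointedCone ℝ (Fin n → ℝ))
  finite : cones.Finite
  bot_mem : ⊥ ∈ cones
  rational : ∀ σ ∈ cones, ∃ s : Finset (Fin n → ℤ), σ = PointedCone.hull ℝ (latVec '' (s : Set _))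
  strongly_convex : ∀ σ ∈ cones, ∀ x ∈ σ, -x ∈ σ → x = 0
  face_mem : ∀ σ ∈ cones, ∀ τ, IsFace τ σ → τ ∈ cones
  inter_face : ∀ σ ∈ cones, ∀ τ ∈ cones, IsFace (σ ⊓ τ) σ

/-- The fan is complete: its cones cover `ℝ ^ n`. -/
def Fan.IsComplete {n : ℕ} (Δ : Fan n) : Prop := ∀ x : Fin n → ℝ, ∃ σ ∈ Δ.cones, x ∈ σ

lemma Fan.isFace_of_le {n : ℕ} (Δ : Fan n) {τ σ : PointedCone ℝ (Fin n → ℝ)} (hτ : τ ∈ Δ.cones)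
    (hσ : σ ∈ Δ.cones) (h : τ ≤ σ) : IsFace τ σ := by
  have := Δ.inter_face σ hσ τ hτ
  rwa [inf_eq_right.mpr h] at this

lemma Fan.inf_mem {n : ℕ} (Δ : Fan n) {τ σ : PointedCone ℝ (Fin n → ℝ)} (hτ : τ ∈ Δ.cones)
    (hσ : σ ∈ Δ.cones) : τ ⊓ σ ∈ Δ.cones := Δ.face_mem τ hτ _ (Δ.inter_face τ hτ σ hσ)

/-! ### The toric variety `X(Δ)` over `K` -/

section Variety

variable (K : Type u) [Field K]

/-- The map `K[S_σ] → K[S_τ]` for `τ ⊆ σ`. -/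
noncomputable def restrictHom {n : ℕ} {τ σ : PointedCone ℝ (Fin n → ℝ)} (h : τ ≤ σ) :
    AddMonoidAlgebra K (dualMonoid σ) →+* AddMonoidAlgebra K (dualMonoid τ) :=
  AddMonoidAlgebra.mapDomainRingHom K (AddSubmonoid.inclusion (dualMonoid_anti h))

lemma restrictHom_single {n : ℕ} {τ σ : PointedCone ℝ (Fin n → ℝ)} (h : τ ≤ σ)
    (m : dualMonoid σ) (c : K) :
    restrictHom K h (AddMonoidAlgebra.single m c) =
      AddMonoidAlgebra.single (⟨m, dualMonoid_anti h m.2⟩ : dualMonoid τ) c := by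
  simp [restrictHom, AddSubmonoid.inclusion]

lemma restrictHom_injective {n : ℕ} {τ σ : PointedCone ℝ (Fin n → ℝ)} (h : τ ≤ σ) :
    Function.Injective (restrictHom K h) :=
  AddMonoidAlgebra.mapDomain_injective (AddSubmonoid.inclusion_injective (dualMonoid_anti h))

lemma exists_add_nsmul_mem {n : ℕ} {τ σ : PointedCone ℝ (Fin n → ℝ)} {s : Finset (Fin n → ℤ)}
    (hs : σ = PointedCone.hull ℝ (latVec '' (s : Set _))) {m : Fin n → ℤ} (hm : m ∈ dualMonoid σ)
    (hτ : ∀ x, x ∈ τ ↔ x ∈ σ ∧ latVec m ⬝ᵥ x = 0) {w : Fin n → ℤ} (hw : w ∈ dualMonoid τ) :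
    ∃ k : ℕ, w + k • m ∈ dualMonoid σ := by
  have hgen : ∀ v ∈ s, latVec v ∈ σ := fun v hv => by
    rw [hs]; exact PointedCone.subset_hull ⟨v, hv, rfl⟩
  have key : ∀ v ∈ s, ∃ k : ℕ, ∀ l : ℕ, k ≤ l →
      0 ≤ latVec w ⬝ᵥ latVec v + l * (latVec m ⬝ᵥ latVec v) := by
    intro v hv
    rcases (hm _ (hgen v hv)).eq_or_lt with h0 | h0
    · refine ⟨0, fun l _ => ?_⟩
      rw [← h0, mul_zero, add_zero]
      exact hw _ ((hτ _).2 ⟨hgen v hv, h0.symm⟩)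
    · obtain ⟨k, hk⟩ := exists_nat_ge (-(latVec w ⬝ᵥ latVec v) / (latVec m ⬝ᵥ latVec v))
      refine ⟨k, fun l hl => ?_⟩
      rw [div_le_iff₀ h0] at hk
      have : (k : ℝ) * (latVec m ⬝ᵥ latVec v) ≤ l * (latVec m ⬝ᵥ latVec v) := by gcongr
      linarith
  choose! k hk using key
  refine ⟨s.sup k, ?_⟩
  rw [mem_dualMonoid]
  intro x hx
  rw [hs] at hx
  induction hx using Submodule.span_induction with
  | mem x hx =>
    obtain ⟨v, hv, rfl⟩ := hx
    rw [latVec_add, latVec_nsmul, add_dotProduct, smul_dotProduct, smul_eq_mul]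
    exact hk v hv _ (Finset.le_sup hv)
  | zero => simp
  | add x y _ _ hx hy => rw [dotProduct_add]; exact add_nonneg hx hy
  | smul a x _ hx =>
    change 0 ≤ _ ⬝ᵥ ((a : ℝ) • x)
    rw [dotProduct_smul]; exact mul_nonneg a.2 hx

/-- For a face `τ = σ ∩ m ^ ⊥`, the ring `K[S_τ]` is the localization of `K[S_σ]` at `χ ^ m`. -/
lemma isLocalization_restrictHom {n : ℕ} {τ σ : PointedCone ℝ (Fin n → ℝ)} (h : τ ≤ σ)
    {s : Finset (Fin n → ℤ)} (hs : σ = PointedCone.hull ℝ (latVec '' (s : Set _)))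
    {m : Fin n → ℤ} (hm : m ∈ dualMonoid σ) (hτ : ∀ x, x ∈ τ ↔ x ∈ σ ∧ latVec m ⬝ᵥ x = 0) :
    letI := (restrictHom K h).toAlgebra
    IsLocalization.Away (AddMonoidAlgebra.single (⟨m, hm⟩ : dualMonoid σ) (1 : K))
      (AddMonoidAlgebra K (dualMonoid τ)) := by
  let _ := (restrictHom K h).toAlgebra
  have halg : ∀ a, algebraMap (AddMonoidAlgebra K (dualMonoid σ))
    (AddMonoidAlgebra K (dualMonoid τ)) a = restrictHom K h a := fun _ => rfl
  have hneg : -m ∈ dualMonoid τ := fun x hx => by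
    have := ((hτ x).1 hx).2
    have h2 : latVec (-m) = -latVec m := by ext i; simp [latVec]
    rw [h2, neg_dotProduct, this, neg_zero]
  refine IsLocalization.Away.mk _ ?_ ?_ ?_
  · rw [halg, restrictHom_single]
    refine IsUnit.of_mul_eq_one (AddMonoidAlgebra.single (⟨-m, hneg⟩ : dualMonoid τ) (1 : K)) ?_
    rw [AddMonoidAlgebra.single_mul_single, AddMonoidAlgebra.one_def]
    congr 1
    · ext1; simp
    · simp
  · intro f
    simp only [halg, ← map_pow]
    induction f using AddMonoidAlgebra.induction_linear with
    | zero => exact ⟨0, 0, by simp⟩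
    | add f g hf hg =>
      obtain ⟨i, a, ha⟩ := hf
      obtain ⟨j, b, hb⟩ := hg
      refine ⟨i + j, a * AddMonoidAlgebra.single (⟨m, hm⟩ : dualMonoid σ) (1 : K) ^ j +
        b * AddMonoidAlgebra.single (⟨m, hm⟩ : dualMonoid σ) (1 : K) ^ i, ?_⟩
      rw [map_add, map_mul, map_mul, ← ha, ← hb, pow_add, map_mul]
      ring
    | single w c =>
      obtain ⟨k, hk⟩ := exists_add_nsmul_mem hs hm hτ w.2
      refine ⟨k, AddMonoidAlgebra.single (⟨w + k • m, hk⟩ : dualMonoid σ) c, ?_⟩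
      rw [AddMonoidAlgebra.single_pow, restrictHom_single, restrictHom_single,
        AddMonoidAlgebra.single_mul_single]
      congr 1
      simp
  · intro a b hab
    exact ⟨0, by simpa using restrictHom_injective K h hab⟩

variable {n : ℕ} (Δ : Fan n)

/-- The diagram of affine toric varieties `U_σ = Spec K[σ^∨ ∩ M]`, `σ ∈ Δ`, with the maps
`U_τ ⟶ U_σ` for `τ ⊆ σ`. -/
noncomputable def Fan.diagram : Δ.cones ⥤ Scheme.{u} where
  obj σ := Spec (CommRingCat.of (AddMonoidAlgebra K (dualMonoid σ.1)))
  map f := Spec.map (CommRingCat.ofHom (restrictHom K (leOfHom f)))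
  map_id σ := by
    rw [← Spec.map_id]
    congr 1
    ext x
    · simp [restrictHom]
    · simp [restrictHom_single]
  map_comp f g := by
    rw [← Spec.map_comp]
    congr 1
    ext x
    · simp [restrictHom]
    · simp [restrictHom_single]

lemma Fan.diagram_map_spec {τ σ : Δ.cones} (f : τ ⟶ σ) {m : Fin n → ℤ}
    (hm : m ∈ dualMonoid σ.1) (hτ : ∀ x, x ∈ τ.1 ↔ x ∈ σ.1 ∧ latVec m ⬝ᵥ x = 0) :
    IsOpenImmersion ((Δ.diagram K).map f) ∧ Set.range ((Δ.diagram K).map f) =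
      (PrimeSpectrum.basicOpen (AddMonoidAlgebra.single (⟨m, hm⟩ : dualMonoid σ.1) (1 : K)) :
        Set (PrimeSpectrum (AddMonoidAlgebra K (dualMonoid σ.1)))) := by
  obtain ⟨s, hs⟩ := Δ.rational σ.1 σ.2
  let _ := (restrictHom K (leOfHom f)).toAlgebra
  have hloc := isLocalization_restrictHom K (leOfHom f) hs hm hτ
  refine ⟨IsOpenImmersion.of_isLocalization
    (AddMonoidAlgebra.single (⟨m, hm⟩ : dualMonoid σ.1) (1 : K)), ?_⟩
  exact PrimeSpectrum.localization_away_comap_range (AddMonoidAlgebra K (dualMonoid τ.1))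
    (AddMonoidAlgebra.single (⟨m, hm⟩ : dualMonoid σ.1) (1 : K))

instance {τ σ : Δ.cones} (f : τ ⟶ σ) : IsOpenImmersion ((Δ.diagram K).map f) := by
  obtain ⟨m, hm, hτ⟩ := Δ.isFace_of_le τ.2 σ.2 (leOfHom f)
  exact (Δ.diagram_map_spec K f hm hτ).1

instance : (Δ.diagram K ⋙ Scheme.forget).IsLocallyDirected where
  cond := by
    intro τ₁ τ₂ σ f₁ f₂ x₁ x₂ hx
    change (Δ.diagram K).map f₁ x₁ = (Δ.diagram K).map f₂ x₂ at hx
    obtain ⟨m₁, hm₁, hτ₁⟩ := Δ.isFace_of_le τ₁.2 σ.2 (leOfHom f₁)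
    obtain ⟨m₂, hm₂, hτ₂⟩ := Δ.isFace_of_le τ₂.2 σ.2 (leOfHom f₂)
    let ρ : Δ.cones := ⟨τ₁.1 ⊓ τ₂.1, Δ.inf_mem τ₁.2 τ₂.2⟩
    let g₁ : ρ ⟶ τ₁ := homOfLE (show τ₁.1 ⊓ τ₂.1 ≤ τ₁.1 from inf_le_left)
    let g₂ : ρ ⟶ τ₂ := homOfLE (show τ₁.1 ⊓ τ₂.1 ≤ τ₂.1 from inf_le_right)
    have hρ : ∀ x, x ∈ ρ.1 ↔ x ∈ σ.1 ∧ latVec (m₁ + m₂) ⬝ᵥ x = 0 := by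
      intro x
      change x ∈ τ₁.1 ∧ x ∈ τ₂.1 ↔ _
      rw [hτ₁, hτ₂, latVec_add, add_dotProduct]
      constructor
      · rintro ⟨⟨h, h₁⟩, -, h₂⟩
        exact ⟨h, by rw [h₁, h₂, add_zero]⟩
      · rintro ⟨h, h₃⟩
        have h₁ := hm₁ x h
        have h₂ := hm₂ x h
        exact ⟨⟨h, by linarith⟩, h, by linarith⟩
    have hr₁ := (Δ.diagram_map_spec K f₁ hm₁ hτ₁).2
    have hr₂ := (Δ.diagram_map_spec K f₂ hm₂ hτ₂).2
    have hr := (Δ.diagram_map_spec K (g₁ ≫ f₁) (add_mem hm₁ hm₂) hρ).2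
    have e : AddMonoidAlgebra.single (⟨m₁ + m₂, add_mem hm₁ hm₂⟩ : dualMonoid σ.1) (1 : K) =
        AddMonoidAlgebra.single ⟨m₁, hm₁⟩ 1 * AddMonoidAlgebra.single ⟨m₂, hm₂⟩ 1 := by
      rw [AddMonoidAlgebra.single_mul_single, one_mul]; rfl
    have hmem : (Δ.diagram K).map f₁ x₁ ∈ Set.range ((Δ.diagram K).map (g₁ ≫ f₁)) := by
      rw [hr, e, PrimeSpectrum.basicOpen_mul]
      refine ⟨?_, ?_⟩
      · have : (Δ.diagram K).map f₁ x₁ ∈ Set.range ((Δ.diagram K).map f₁) := ⟨_, rfl⟩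
        rwa [hr₁] at this
      · have : (Δ.diagram K).map f₁ x₁ ∈ Set.range ((Δ.diagram K).map f₂) := ⟨x₂, hx.symm⟩
        rwa [hr₂] at this
    obtain ⟨y, hy⟩ := hmem
    refine ⟨ρ, g₁, g₂, y, ?_, ?_⟩
    · apply ((Δ.diagram K).map f₁).isOpenEmbedding.injective
      change (Δ.diagram K).map f₁ ((Δ.diagram K).map g₁ y) = _
      rw [← hy, Functor.map_comp]; rfl
    · apply ((Δ.diagram K).map f₂).isOpenEmbedding.injective
      change (Δ.diagram K).map f₂ ((Δ.diagram K).map g₂ y) = (Δ.diagram K).map f₂ x₂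
      rw [← hx, ← hy, show g₁ ≫ f₁ = g₂ ≫ f₂ from Subsingleton.elim _ _, Functor.map_comp]; rfl

/-- The toric variety `X(Δ)` over `K`: the gluing of the `U_σ = Spec K[σ^∨ ∩ M]`, `σ ∈ Δ`, along
the open immersions `U_τ ⟶ U_σ` for the faces `τ` of `σ`. -/
noncomputable def Fan.toricVariety : Scheme.{u} := colimit (Δ.diagram K)

/-- The torus `T = Spec K[M]`, as the chart of the cone `{0}`, for which `S_σ = M`. -/
noncomputable abbrev Fan.torus : Scheme.{u} :=
  Spec (CommRingCat.of (AddMonoidAlgebra K (dualMonoid (⊥ : PointedCone ℝ (Fin n → ℝ)))))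

/-- The inclusion of the torus in `X(Δ)`. -/
noncomputable def Fan.torusInclusion : Fan.torus K (n := n) ⟶ Δ.toricVariety K :=
  colimit.ι (Δ.diagram K) ⟨⊥, Δ.bot_mem⟩

end Variety

/-! ### `T`-divisors, their polytopes, and very ampleness -/

section Divisor

variable {n : ℕ}

/-- The primitive generators `v` of the rays (one-dimensional cones) `ℝ≥0 v` of the fan. -/
def Fan.rays (Δ : Fan n) : Set (Fin n → ℤ) :=
  {v | (∀ k : ℤ, (∀ i, k ∣ v i) → IsUnit k) ∧ PointedCone.hull ℝ {latVec v} ∈ Δ.cones}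

/-- A `T`-divisor `D = ∑ a_v D_v` on `X(Δ)`, where `D_v` is the prime divisor of the ray of `v`,
given by its coefficients `a_v`. -/
abbrev Fan.TDivisor (Δ : Fan n) : Type := Δ.rays → ℤ

variable {Δ : Fan n} (D : Δ.TDivisor)

/-- `P_D = {u ∈ M_ℝ | ⟨u, v⟩ ≥ - a_v for all rays v}`. -/
def polytope : Set (Fin n → ℝ) := {u | ∀ v : Δ.rays, -(D v : ℝ) ≤ u ⬝ᵥ latVec v}

/-- `P_D ∩ M`; the characters `χ ^ u` of these `u` form a basis of `Γ(X, O(D))`. -/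
def latticePoints : Set (Fin n → ℤ) := {u | latVec u ∈ polytope D}

/-- `O(D)` is a line bundle generated by its global sections: on every `U_σ`, some global section
`χ ^ u` with `u ∈ P_D ∩ M` is a generator of `O(D)`, that is, `div (χ ^ u) + D = 0` on `U_σ`. -/
def IsGloballyGenerated : Prop :=
  ∀ σ ∈ Δ.cones, ∃ u ∈ latticePoints D,
    ∀ v : Δ.rays, latVec v ∈ σ → latVec u ⬝ᵥ latVec v = -(D v : ℝ)

section VeryAmple

attribute [local instance] MvPolynomial.gradedAlgebra

variable (K : Type u) [Field K]

/-- The projective space over `K` with homogeneous coordinates `Y_u`, `u ∈ P_D ∩ M`. -/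
noncomputable def projectiveSpace : Scheme.{u} :=
  Proj (MvPolynomial.homogeneousSubmodule (latticePoints D) K)

/-- `Y_u ↦ χ ^ u`, from the homogeneous coordinate ring to the functions on the torus. -/
noncomputable def coordHom : MvPolynomial (latticePoints D) K →+*
    AddMonoidAlgebra K (dualMonoid (⊥ : PointedCone ℝ (Fin n → ℝ))) :=
  (MvPolynomial.aeval (R := K) fun u : latticePoints D =>
    (AddMonoidAlgebra.single ⟨u.1, fun x hx => by rw [(Submodule.mem_bot _).1 hx]; simp⟩ 1 :
      AddMonoidAlgebra K (dualMonoid (⊥ : PointedCone ℝ (Fin n → ℝ))))).toRingHom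

/-- `Y_u ↦ χ ^ u`, with values in the global sections of the torus. -/
noncomputable def coordSections :
    MvPolynomial (latticePoints D) K →+* Γ(Fan.torus K (n := n), ⊤) :=
  (Scheme.ΓSpecIso _).inv.hom.comp (coordHom D K)

lemma map_irrelevant_coordSections (h : (latticePoints D).Nonempty) :
    (HomogeneousIdeal.irrelevant (MvPolynomial.homogeneousSubmodule
      (latticePoints D) K)).toIdeal.map (coordSections D K) = ⊤ := by
  obtain ⟨u, hu⟩ := h
  have hX : (MvPolynomial.X ⟨u, hu⟩ : MvPolynomial (latticePoints D) K) ∈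
      (HomogeneousIdeal.irrelevant (MvPolynomial.homogeneousSubmodule
        (latticePoints D) K)).toIdeal := by
    rw [HomogeneousIdeal.mem_iff, HomogeneousIdeal.mem_irrelevant_iff]
    rw [GradedRing.proj_apply]
    exact DirectSum.decompose_of_mem_ne _
      ((MvPolynomial.mem_homogeneousSubmodule 1 _).2 (MvPolynomial.isHomogeneous_X K _))
      one_ne_zero
  refine Ideal.eq_top_of_isUnit_mem _ (Ideal.mem_map_of_mem _ hX) ?_
  refine IsUnit.map (Scheme.ΓSpecIso _).inv.hom ?_
  refine IsUnit.of_mul_eq_one (AddMonoidAlgebra.single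
    ⟨-u, fun x hx => by rw [(Submodule.mem_bot _).1 hx]; simp⟩ (1 : K)) ?_
  simp only [coordHom, AlgHom.toRingHom_eq_coe, RingHom.coe_coe, MvPolynomial.aeval_X]
  rw [AddMonoidAlgebra.single_mul_single, AddMonoidAlgebra.one_def]
  congr 1
  · ext1; simp
  · simp

/-- The morphism `T ⟶ ℙ ^ (r - 1)`, `x ↦ (χ ^ u₁ (x) : … : χ ^ u_r (x))`, where
`P_D ∩ M = {u₁, …, u_r}`. -/
noncomputable def torusMap (h : (latticePoints D).Nonempty) :
    Fan.torus K (n := n) ⟶ projectiveSpace D K :=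
  Proj.fromOfGlobalSections _ (coordSections D K) (map_irrelevant_coordSections D K h)

/-- `D` is very ample: `O(D)` is a line bundle generated by its global sections, and the morphism
`φ_D : X(Δ) ⟶ ℙ ^ (r - 1)` which they define is a closed immersion.  As `X(Δ)` is integral,
`φ_D` is the only morphism given by `x ↦ (χ ^ u₁ (x) : … : χ ^ u_r (x))` on the torus. -/
def IsVeryAmple : Prop :=
  IsGloballyGenerated D ∧ ∃ (h : (latticePoints D).Nonempty)
    (φ : Δ.toricVariety K ⟶ projectiveSpace D K),
    Δ.torusInclusion K ≫ φ = torusMap D K h ∧ IsClosedImmersion φ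

end VeryAmple

/-! ### The homogeneous coordinate ring and the Hilbert-Kunz density function -/

/-- The semigroup `S` generated by the `(u, 1)`, `u ∈ P_D ∩ M`. -/
def coordMonoid : AddSubmonoid ((Fin n → ℤ) × ℤ) :=
  AddSubmonoid.closure {s | s.1 ∈ latticePoints D ∧ s.2 = 1}

/-- The homogeneous coordinate ring `K[S]`. -/
abbrev coordRing (K : Type u) [Field K] : Type u := AddMonoidAlgebra K (coordMonoid D)

/-- The graded pieces of `K[S]`, the generators `χ ^ (u, 1)` being of degree `1`. -/
noncomputable def coordGrading (K : Type u) [Field K] (k : ℤ) : Submodule K (coordRing D K) :=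
  AddMonoidAlgebra.gradeBy K (fun s : coordMonoid D => s.1.2) k

end Divisor

/-- The graded maximal ideal, generated by the homogeneous elements of positive degree. -/
def gradedMaximalIdeal {K R : Type*} [Field K] [CommRing R] [Algebra K R] (𝒜 : ℤ → Submodule K R) :
    Ideal R := Ideal.span {f | ∃ k : ℤ, 0 < k ∧ f ∈ 𝒜 k}

/-- The ideal `I ^ [q]` generated by the `q`-th powers of the elements of `I`. -/
def frobeniusPower {R : Type*} [CommRing R] (I : Ideal R) (q : ℕ) : Ideal R :=
  Ideal.span {f | ∃ g ∈ I, f = g ^ q}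

/-- For a graded `K`-algebra `R = ⊕ 𝒜 k` of dimension `d` and `q = p ^ m`, the function
`f_m (x) = (1 / q ^ (d - 1)) ℓ (R / I ^ [q])_⌊x q⌋`; the length of the graded piece is its
dimension over `K`. -/
noncomputable def hkApprox {K R : Type*} [Field K] [CommRing R] [Algebra K R]
    (𝒜 : ℤ → Submodule K R) (I : Ideal R) (d p m : ℕ) (x : ℝ) : ℝ :=
  (Module.finrank K
    ((𝒜 ⌊x * (p : ℝ) ^ m⌋).map (Ideal.Quotient.mkₐ K (frobeniusPower I (p ^ m))).toLinearMap) : ℝ)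
      / ((p : ℝ) ^ m) ^ (d - 1)

/-- The approximations `f_m` of the Hilbert-Kunz density function of `(X, D)`, that is, of `K[S]`
(a ring of dimension `dim X + 1 = n + 1`) with respect to its graded maximal ideal. -/
noncomputable def pairApprox {n : ℕ} {Δ : Fan n} (D : Δ.TDivisor) (K : Type u) [Field K]
    (p m : ℕ) (x : ℝ) : ℝ :=
  hkApprox (coordGrading D K) (gradedMaximalIdeal (coordGrading D K)) (n + 1) p m x

/-- The Hilbert-Kunz density function `HKd(X, D)(x) = lim f_m (x)`. -/
noncomputable def HKd {n : ℕ} {Δ : Fan n} (D : Δ.TDivisor) (K : Type u) [Field K]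
    (p : ℕ) (x : ℝ) : ℝ :=
  Filter.limUnder Filter.atTop fun m => pairApprox D K p m x

/-! ### The region `𝒫_D` -/

/-- The cone `C_D` in `M_ℝ × ℝ` spanned by `P_D × {1}`. -/
def polytopeCone {n : ℕ} {Δ : Fan n} (D : Δ.TDivisor) : PointedCone ℝ ((Fin n → ℝ) × ℝ) :=
  PointedCone.hull ℝ (polytope D ×ˢ {1})

/-- `𝒫_D`: the points of `C_D` that lie in no translate `(u, 1) + C_D`, `u ∈ P_D ∩ M`. -/
def region {n : ℕ} {Δ : Fan n} (D : Δ.TDivisor) : Set ((Fin n → ℝ) × ℝ) :=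
  {z | z ∈ polytopeCone D ∧ ∀ u ∈ latticePoints D, z - (latVec u, 1) ∉ polytopeCone D}

end Toric

/-!
# The Hilbert-Kunz density function of a toric pair

Write `S` for the semigroup generated by the `(u, 1)`, `u ∈ P_D ∩ M`, and `C` for the cone over
`P_D`.  In characteristic `p` the ideal `𝔪 ^ [q]` of `K[S]` is the monomial ideal generated by the
`χ ^ (q u, q)` (`mem_frobeniusPower_iff`), so the dimension of the degree `k` piece of
`K[S] / 𝔪 ^ [q]` is the number of `s ∈ S` of degree `k` that lie in no `q (u, 1) + S`
(`pairApprox_eq`).  For `k = ⌊q x⌋` this number, divided by `q ^ n`, is the volume of the set of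
those `y ∈ ℝ ^ n` for which `s = (⌊q y⌋, ⌊q x⌋)` is counted (`volume_floor_mem`).  As `q → ∞`,
`s / q` tends to `(y, x)`, and `(s - q (u, 1)) / q` to `(y, x) - (u, 1)`.  If none of these limits
lies on the boundary of `C`, then `s` is eventually counted if and only if `(y, x)` lies in the
region, or equivalently in its closure (`eventually_mem_monomialsOutside_iff`).  Slices of the
boundary of `C` are null sets, being contained in boundaries of convex sets
(`volume_slice_frontier`), so dominated convergence gives the theorem
(`tendsto_ncard_monomialsOutside`).

What makes `S` asymptotically as good as the set of all lattice points of `C` is a conductor: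
`s₀ + (C ∩ ℤ ^ (n + 1)) ⊆ S` for some `s₀` (`exists_conductor`).  It exists for two reasons.

* `C` is generated by the `(u, 1)`, that is, `P_D` is the convex hull of its lattice points
  (`polytope_subset_convexHull`).  A linear functional on `M_ℝ` lies in some cone `σ` of the
  complete fan, and a lattice point `u_σ` that generates `O(D)` on `U_σ` minimizes it on `P_D`,
  because `σ` is generated by rays of the fan (`Fan.le_hull_rays`).
* `S` generates the group `ℤ ^ (n + 1)`.  The restriction of the closed immersion to the torus is a
  monomorphism.  If `H` is the subgroup generated by the differences `u - u'`, then the two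
  homomorphisms `K[M] → K[M / H]` given by `χ ^ m ↦ χ ^ [m]` and `χ ^ m ↦ 1` define the same point
  of projective space, so they are equal and `H = M` (`closure_latticePoints_sub`).
-/

namespace Toric

open Filter Topology MeasureTheory

/-! ### Morphisms to `Proj` with a non-vanishing section -/

/-- If a homogeneous `r` goes to a unit, the morphism to `Proj` defined by global sections has image
in the affine chart `D₊(r)`, where it is given by `a / r ^ k ↦ f a / (f r) ^ k`. -/
lemma fromOfGlobalSections_eq_of_isUnit {σ : Type*} {A : Type u} [CommRing A] [SetLike σ A]
    [AddSubgroupClass σ A] (𝒜 : ℕ → σ) [GradedRing 𝒜] {X : Scheme.{u}} (f : A →+* Γ(X, ⊤))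
    (hf : (HomogeneousIdeal.irrelevant 𝒜).toIdeal.map f = ⊤) {r : A} {d : ℕ} (hd : 0 < d)
    (hr : r ∈ 𝒜 d) (hu : IsUnit (f r)) :
    Proj.fromOfGlobalSections 𝒜 f hf = X.toSpecΓ ≫
      Spec.map (CommRingCat.ofHom ((IsLocalization.Away.lift r hu).comp
        (algebraMap (HomogeneousLocalization.Away 𝒜 r) (Localization.Away r)))) ≫
      Proj.awayι 𝒜 r hr hd := by
  have htop : X.basicOpen (f r) = ⊤ := Scheme.basicOpen_of_isUnit _ hu
  have : IsIso (X.basicOpen (f r)).ι := by rw [htop]; exact (Scheme.topIso X).isIso_hom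
  -- compare with the restriction of the morphism to `D(f r)`, which is all of `X`
  rw [← cancel_epi (X.basicOpen (f r)).ι]
  have h1 := Proj.fromOfGlobalSections_resLE 𝒜 f hf hd hr
  have h2 := congrArg (· ≫ (Proj.basicOpen 𝒜 r).ι) h1
  simp only [Scheme.Hom.resLE_comp_ι] at h2
  rw [h2]
  have key : (X.isoOfEq (X.toSpecΓ_preimage_basicOpen (f r))).inv ≫
      X.toSpecΓ ∣_ (PrimeSpectrum.basicOpen (f r)) ≫ (basicOpenIsoSpecAway (f r)).hom =
      (X.basicOpen (f r)).ι ≫ X.toSpecΓ ≫ Spec.map (CommRingCat.ofHom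
        (IsLocalization.Away.lift (S := Localization.Away (f r)) (f r)
          (g := RingHom.id _) hu)) := by
    have : Mono (Spec.map (CommRingCat.ofHom
      (algebraMap Γ(X, ⊤) (Localization.Away (f r))))) := inferInstance
    rw [← cancel_mono (Spec.map (CommRingCat.ofHom
      (algebraMap Γ(X, ⊤) (Localization.Away (f r)))))]
    simp only [Category.assoc]
    rw [← Spec.map_comp, ← CommRingCat.ofHom_comp, IsLocalization.Away.lift_comp]
    have e := morphismRestrict_ι X.toSpecΓ
      (show (Spec Γ(X, ⊤)).Opens from PrimeSpectrum.basicOpen (f r))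
    have e2 : (X.isoOfEq (X.toSpecΓ_preimage_basicOpen (f r))).inv ≫
      (X.toSpecΓ ⁻¹ᵁ (show (Spec Γ(X, ⊤)).Opens from PrimeSpectrum.basicOpen (f r))).ι ≫
      X.toSpecΓ = (X.basicOpen (f r)).ι ≫ X.toSpecΓ := by
      rw [← Category.assoc]
      congr 1
      exact Scheme.isoOfEq_inv_ι _ _
    refine Eq.trans ?_ (e2.trans ?_)
    · rw [← e]
      rw [basicOpenIsoSpecAway_hom_SpecMap]
    · erw [Spec.map_id, Category.comp_id]
  simp only [Proj.toBasicOpenOfGlobalSections, Category.assoc, Proj.basicOpenIsoSpec_inv_ι]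
  rw [reassoc_of% key, ← Spec.map_comp_assoc]
  congr 4
  rw [← CommRingCat.ofHom_comp, ← RingHom.comp_assoc]
  congr 2
  apply IsLocalization.ringHom_ext (M := Submonoid.powers r)
  ext i
  simp

instance (K : Type u) [Field K] {n} (Δ : Fan n) : IsOpenImmersion (Δ.torusInclusion K) := by
  have : Finite Δ.cones := Δ.finite
  exact (Scheme.IsLocallyDirected.openCover (Δ.diagram K)).map_prop ⟨⊥, Δ.bot_mem⟩

/-! ### The torus in projective space and the lattice generated by `P_D ∩ M` -/

section
attribute [local instance] MvPolynomial.gradedAlgebra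

/-- The morphism from the torus is an open immersion followed by the closed immersion `φ_D`. -/
lemma mono_torusMap_of_isVeryAmple {n : ℕ} {Δ : Fan n} {D : Δ.TDivisor} {K : Type u} [Field K]
    (hD : IsVeryAmple D K) : ∃ h : (latticePoints D).Nonempty, Mono (torusMap D K h) := by
  obtain ⟨-, h, φ, hφ, hc⟩ := hD
  refine ⟨h, ?_⟩
  rw [← hφ]
  infer_instance

/-- If the morphism `Spec B ⟶ Proj A` given by `f : A → B` is a monomorphism, then two homomorphisms
`φ₁, φ₂ : B → C` coincide as soon as they agree on the image of `A` up to scaling `Aₖ` by the `k`-th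
power of one element: such homomorphisms define the same point of `Proj A`. -/
lemma ringHom_eq_of_mono_fromOfGlobalSections {σ : Type*} {A : Type u} [CommRing A] [SetLike σ A]
    [AddSubgroupClass σ A] (𝒜 : ℕ → σ) [GradedRing 𝒜] {B C : Type u} [CommRing B] [CommRing C]
    (f : A →+* Γ(Spec (CommRingCat.of B), ⊤))
    (hf : (HomogeneousIdeal.irrelevant 𝒜).toIdeal.map f = ⊤)
    (hmono : Mono (Proj.fromOfGlobalSections 𝒜 f hf)) (f₀ : A →+* B)
    (hf₀ : f = (Scheme.ΓSpecIso (CommRingCat.of B)).inv.hom.comp f₀) {r : A}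
    (hr : r ∈ 𝒜 1) (hr' : IsUnit (f₀ r))
    (φ₁ φ₂ : B →+* C) (c : C) (hc : ∀ k, ∀ a ∈ 𝒜 k, φ₁ (f₀ a) = c ^ k * φ₂ (f₀ a)) :
    φ₁ = φ₂ := by
  suffices h : CommRingCat.ofHom φ₁ = CommRingCat.ofHom φ₂ from congrArg CommRingCat.Hom.hom h
  refine Spec.map_injective ((cancel_mono (Proj.fromOfGlobalSections 𝒜 _ hf)).1 ?_)
  have hf₁ : ∀ a, (Scheme.ΓSpecIso (.of B)).hom.hom (f a) = f₀ a := fun a => by simp [hf₀]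
  have hu : IsUnit (f r) := hf₀ ▸ IsUnit.map (Scheme.ΓSpecIso (CommRingCat.of B)).inv.hom hr'
  simp only [← hf₁] at hc
  rw [fromOfGlobalSections_eq_of_isUnit 𝒜 f hf one_pos hr hu]
  rw [← SpecMap_ΓSpecIso_hom]
  simp only [← Spec.map_comp_assoc]
  congr 2
  ext a
  obtain ⟨k, a, ha, rfl⟩ := HomogeneousLocalization.Away.mk_surjective 𝒜 hr a
  simp only [CommRingCat.hom_comp, CommRingCat.hom_ofHom, RingHom.comp_apply]
  -- a point of `D₊(r)` is determined by the values of the fractions `a / r ^ k`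
  set z := (IsLocalization.Away.lift r hu)
    ((algebraMap (HomogeneousLocalization.Away 𝒜 r) (Localization.Away r))
      (HomogeneousLocalization.Away.mk 𝒜 hr k a ha)) with hz
  have hz' : z * f r ^ k = f a := by
    have e : (HomogeneousLocalization.Away.mk 𝒜 hr k a ha).val * algebraMap A _ r ^ k =
        algebraMap A (Localization.Away r) a := by
      rw [HomogeneousLocalization.Away.val_mk, ← map_pow, Localization.mk_eq_mk']
      exact IsLocalization.mk'_spec _ _ _
    have e' := congrArg (IsLocalization.Away.lift r hu) e
    rwa [map_mul, map_pow, IsLocalization.Away.lift_eq, IsLocalization.Away.lift_eq] at e'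
  have h₁ := hc _ a ha
  have h₂ := hc 1 r hr
  have hu' : IsUnit (φ₁ ((Scheme.ΓSpecIso (.of B)).hom.hom (f r))) := (hu.map _).map _
  rw [← hz'] at h₁
  simp only [map_mul, map_pow, smul_eq_mul, mul_one, pow_one] at h₁ h₂
  refine (hu'.pow k).mul_right_cancel (h₁.trans ?_)
  rw [h₂]
  ring

lemma coordHom_X {n : ℕ} {Δ : Fan n} (D : Δ.TDivisor) (K : Type u) [Field K]
    (u : latticePoints D) : coordHom D K (MvPolynomial.X u) =
      AddMonoidAlgebra.single ⟨u.1, fun x hx => by rw [(Submodule.mem_bot _).1 hx]; simp⟩ 1 := by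
  simp [coordHom]

lemma coordHom_C {n : ℕ} {Δ : Fan n} (D : Δ.TDivisor) (K : Type u) [Field K] (c : K) :
    coordHom D K (MvPolynomial.C c) = AddMonoidAlgebra.single 0 c := by
  simp [coordHom]

lemma isUnit_coordHom_X {n : ℕ} {Δ : Fan n} (D : Δ.TDivisor) (K : Type u) [Field K]
    (u : latticePoints D) : IsUnit (coordHom D K (MvPolynomial.X u)) := by
  refine IsUnit.of_mul_eq_one (AddMonoidAlgebra.single
    ⟨-u, fun x hx => by rw [(Submodule.mem_bot _).1 hx]; simp⟩ (1 : K)) ?_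
  rw [coordHom_X, AddMonoidAlgebra.single_mul_single, AddMonoidAlgebra.one_def]
  congr 1
  · ext1; simp
  · simp

lemma eq_pow_mul_of_isHomogeneous {σ K C : Type*} [CommRing K] [CommRing C]
    (ψ₁ ψ₂ : MvPolynomial σ K →+* C) (c : C)
    (hC : ∀ a, ψ₁ (MvPolynomial.C a) = ψ₂ (MvPolynomial.C a))
    (hX : ∀ i, ψ₁ (MvPolynomial.X i) = c * ψ₂ (MvPolynomial.X i)) {k : ℕ} {a : MvPolynomial σ K}
    (ha : a.IsHomogeneous k) : ψ₁ a = c ^ k * ψ₂ a := by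
  rw [a.as_sum, map_sum, map_sum, Finset.mul_sum]
  refine Finset.sum_congr rfl fun m hm => ?_
  have hdeg := ha.degree_eq_sum_deg_support hm
  rw [MvPolynomial.monomial_eq, map_mul, map_mul, hC, Finsupp.prod, map_prod, map_prod]
  simp only [map_pow, hX, mul_pow, Finset.prod_mul_distrib, Finset.prod_pow_eq_pow_sum]
  rw [hdeg]
  ring

lemma ringHom_eq_of_mono_torusMap {n : ℕ} {Δ : Fan n} {D : Δ.TDivisor} {K : Type u} [Field K]
    (h : (latticePoints D).Nonempty) [Mono (torusMap D K h)] {C : Type u} [CommRing C]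
    (φ₁ φ₂ : AddMonoidAlgebra K (dualMonoid (⊥ : PointedCone ℝ (Fin n → ℝ))) →+* C) (c : C)
    (hC : ∀ a, φ₁ (AddMonoidAlgebra.single 0 a) = φ₂ (AddMonoidAlgebra.single 0 a))
    (hX : ∀ u : latticePoints D, φ₁ (coordHom D K (MvPolynomial.X u)) =
      c * φ₂ (coordHom D K (MvPolynomial.X u))) : φ₁ = φ₂ := by
  obtain ⟨u₀, hu₀⟩ := id h
  have h1 : Mono (Proj.fromOfGlobalSections
    (MvPolynomial.homogeneousSubmodule (latticePoints D) K) (coordSections D K)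
      (map_irrelevant_coordSections D K h)) := ‹Mono (torusMap D K h)›
  have h2 : coordSections D K = (Scheme.ΓSpecIso (CommRingCat.of _)).inv.hom.comp (coordHom D K) :=
    rfl
  have h3 := (MvPolynomial.mem_homogeneousSubmodule 1 _).2
    (MvPolynomial.isHomogeneous_X K (⟨u₀, hu₀⟩ : latticePoints D))
  have h4 : ∀ k, ∀ a ∈ MvPolynomial.homogeneousSubmodule (latticePoints D) K k,
      φ₁ (coordHom D K a) = c ^ k * φ₂ (coordHom D K a) := fun k a ha =>
    eq_pow_mul_of_isHomogeneous (φ₁.comp (coordHom D K)) (φ₂.comp (coordHom D K)) c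
        (fun a => by simpa only [RingHom.comp_apply, coordHom_C] using hC a) hX
        ((MvPolynomial.mem_homogeneousSubmodule k a).1 ha)
  exact ringHom_eq_of_mono_fromOfGlobalSections _ _ _ h1 _ h2 h3
    (isUnit_coordHom_X D K ⟨u₀, hu₀⟩) φ₁ φ₂ c h4

end

lemma mapDomainRingHom_single {R A B : Type*} [Semiring R] [AddMonoid A] [AddMonoid B] (f : A →+ B)
    (a : A) (r : R) : AddMonoidAlgebra.mapDomainRingHom R f (AddMonoidAlgebra.single a r) =
      AddMonoidAlgebra.single (f a) r := AddMonoidAlgebra.mapDomain_single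

/-- If the torus maps monomorphically to projective space, then the differences of lattice points of
`P_D` generate `M`. -/
lemma closure_latticePoints_sub {n : ℕ} {Δ : Fan n} {D : Δ.TDivisor} {K : Type u} [Field K]
    (h : (latticePoints D).Nonempty) [Mono (torusMap D K h)] (u₀ : Fin n → ℤ) :
    AddSubgroup.closure ((fun u => u - u₀) '' latticePoints D) = ⊤ := by
  set H := AddSubgroup.closure ((fun u => u - u₀) '' latticePoints D)
  let S := dualMonoid (⊥ : PointedCone ℝ (Fin n → ℝ))
  have key := ringHom_eq_of_mono_torusMap h
    (AddMonoidAlgebra.mapDomainRingHom K ((QuotientAddGroup.mk' H).comp S.subtype))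
    (AddMonoidAlgebra.mapDomainRingHom K (0 : S →+ (Fin n → ℤ) ⧸ H))
    (AddMonoidAlgebra.single (QuotientAddGroup.mk' H u₀) 1)
    (fun a => by simp only [mapDomainRingHom_single, map_zero])
    (fun u => by
      rw [coordHom_X, mapDomainRingHom_single, mapDomainRingHom_single,
        AddMonoidAlgebra.single_mul_single, one_mul]
      congr 1
      refine (QuotientAddGroup.eq.2 ?_).symm
      have hmem : u.1 - u₀ ∈ H := AddSubgroup.subset_closure ⟨u, u.2, rfl⟩
      rw [sub_eq_neg_add] at hmem
      simpa using hmem)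
  rw [eq_top_iff]
  intro m _
  have := congr($key (AddMonoidAlgebra.single
    ⟨m, fun x hx => by rw [(Submodule.mem_bot _).1 hx]; simp⟩ 1))
  rw [mapDomainRingHom_single, mapDomainRingHom_single,
    AddMonoidAlgebra.single_left_inj one_ne_zero] at this
  exact (QuotientAddGroup.eq_zero_iff m).1 this

/-! ### The cones of a fan are generated by rays -/

/-- In a salient finitely generated cone, a generator that is not redundant spans a face: some
functional vanishes on it and is positive on the other generators. -/
lemma exists_dual_of_irredundant {E : Type*} [NormedAddCommGroup E] [NormedSpace ℝ E]
    [FiniteDimensional ℝ E] {t : Finset E} {v : E} (ht : (0 : E) ∉ t)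
    (hv : v ∉ PointedCone.hull ℝ (t : Set E))
    (hσ : ∀ x ∈ PointedCone.hull ℝ (insert v (t : Set E)),
      -x ∈ PointedCone.hull ℝ (insert v (t : Set E)) → x = 0) :
    ∃ f : E →L[ℝ] ℝ, f v = 0 ∧ ∀ w ∈ t, 0 < f w := by
  classical
  have hsub : PointedCone.hull ℝ (t : Set E) ≤ PointedCone.hull ℝ (insert v (t : Set E)) :=
    Submodule.span_mono (Set.subset_insert _ _)
  have hvmem : v ∈ PointedCone.hull ℝ (insert v (t : Set E)) :=
    PointedCone.subset_hull (Set.mem_insert _ _)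
  -- separate the line through `v` from the convex hull of the other generators
  have hdisj : Disjoint ((Submodule.span ℝ {v} : Submodule ℝ E) : Set E)
      (convexHull ℝ (t : Set E)) := by
    rw [Set.disjoint_left]
    intro a ha hat
    obtain ⟨c, rfl⟩ := Submodule.mem_span_singleton.1 ha
    obtain ⟨w, hw0, hw1, hwa⟩ := Finset.mem_convexHull'.1 hat
    have hmem : ∀ t' ⊆ t, ∑ y ∈ t', w y • y ∈ PointedCone.hull ℝ (t : Set E) := fun t' ht' =>
      Submodule.sum_mem _ fun y hy => PointedCone.smul_mem _ (hw0 y (ht' hy))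
        (PointedCone.subset_hull (ht' hy))
    rcases lt_or_ge 0 c with hc | hc
    · apply hv
      have := PointedCone.smul_mem _ (inv_nonneg.2 hc.le) (hmem t subset_rfl)
      rwa [hwa, smul_smul, inv_mul_cancel₀ hc.ne', one_smul] at this
    · have h0 : ∑ y ∈ t, w y • y = 0 := by
        refine hσ _ (hsub (hmem t subset_rfl)) ?_
        rw [hwa, ← neg_smul]
        exact PointedCone.smul_mem _ (neg_nonneg.2 hc) hvmem
      obtain ⟨y, hy, hwy⟩ : ∃ y ∈ t, 0 < w y := by
        by_contra! h
        have := Finset.sum_nonpos h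
        linarith
      have hyz : w y • y = 0 := by
        refine hσ _ (hsub (PointedCone.smul_mem _ hwy.le (PointedCone.subset_hull hy))) ?_
        have : -(w y • y) = ∑ y ∈ t.erase y, w y • y := by
          rw [neg_eq_iff_add_eq_zero, Finset.add_sum_erase t (fun y => w y • y) hy, h0]
        rw [this]
        exact hsub (hmem _ (Finset.erase_subset _ _))
      rcases smul_eq_zero.1 hyz with h | h
      · exact hwy.ne' h
      · exact ht (h ▸ hy)
  obtain ⟨f, a, b, hfa, hab, hfb⟩ := geometric_hahn_banach_closed_compact
    (Submodule.span ℝ {v}).convex (Submodule.closed_of_finiteDimensional _)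
    (convex_convexHull ℝ _) (t.finite_toSet.isCompact_convexHull (𝕜 := ℝ)) hdisj
  have h0 : 0 < a := by simpa using hfa 0 (zero_mem _)
  refine ⟨f, ?_, fun w hw => h0.trans (hab.trans (hfb w (subset_convexHull ℝ _ hw)))⟩
  -- a functional bounded above on a line through the origin vanishes on it
  by_contra hne
  have := hfa ((a / f v) • v) (Submodule.smul_mem _ _ (Submodule.mem_span_singleton_self v))
  rw [map_smul, smul_eq_mul, div_mul_cancel₀ _ hne] at this
  exact lt_irrefl _ this

lemma eq_dotProduct {n : ℕ} (f : (Fin n → ℝ) →L[ℝ] ℝ) (x : Fin n → ℝ) :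
    f x = x ⬝ᵥ fun i => f (Pi.single i 1) := by
  have := LinearMap.pi_apply_eq_sum_univ f.toLinearMap x
  simp only [ContinuousLinearMap.coe_coe, smul_eq_mul] at this
  rw [this, dotProduct]
  refine Finset.sum_congr rfl fun i _ => ?_
  congr 2
  ext j
  simp [Pi.single_apply, eq_comm]

lemma tendsto_floor_mul_div (y : ℝ) {a : ℕ → ℝ} (ha : Tendsto a atTop atTop) :
    Tendsto (fun N => (⌊y * a N⌋ : ℝ) / a N) atTop (𝓝 y) := by
  have h : Tendsto (fun N => y - (a N)⁻¹) atTop (𝓝 y) := by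
    simpa using tendsto_const_nhds.sub (tendsto_inv_atTop_zero.comp ha)
  refine tendsto_of_tendsto_of_tendsto_of_le_of_le' h tendsto_const_nhds ?_ ?_
  · filter_upwards [ha.eventually_gt_atTop 0] with N hN
    rw [le_div_iff₀ hN, sub_mul, inv_mul_cancel₀ hN.ne']
    exact (Int.sub_one_lt_floor _).le
  · filter_upwards [ha.eventually_gt_atTop 0] with N hN
    rw [div_le_iff₀ hN]
    exact Int.floor_le _

lemma tendsto_latVec_floor {n : ℕ} (y : Fin n → ℝ) {a : ℕ → ℝ} (ha : Tendsto a atTop atTop) :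
    Tendsto (fun N => (a N)⁻¹ • latVec fun i => ⌊y i * a N⌋) atTop (𝓝 y) := by
  rw [tendsto_pi_nhds]
  intro i
  refine (tendsto_floor_mul_div (y i) ha).congr fun N => ?_
  simp [latVec, div_eq_inv_mul]

lemma latVec_sub {n : ℕ} (v w : Fin n → ℤ) : latVec (v - w) = latVec v - latVec w := by
  ext i; simp [latVec]

lemma latVec_zsmul {n : ℕ} (k : ℤ) (v : Fin n → ℤ) : latVec (k • v) = (k : ℝ) • latVec v := by
  ext i; simp [latVec]

lemma latVec_dotProduct {n : ℕ} (v w : Fin n → ℤ) : latVec v ⬝ᵥ latVec w = ((v ⬝ᵥ w : ℤ) : ℝ) := by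
  simp [latVec, dotProduct]

lemma latVec_injective {n : ℕ} : Function.Injective (latVec (n := n)) := fun v w h => by
  ext i; simpa [latVec] using congrFun h i

/-- A real functional that vanishes on a lattice vector and is positive on finitely many others can
be replaced by a lattice functional. -/
lemma exists_lattice_dual {n : ℕ} {s : Finset (Fin n → ℤ)} {v : Fin n → ℤ} {y : Fin n → ℝ}
    (hv : y ⬝ᵥ latVec v = 0) (hv0 : v ≠ 0) (hs : ∀ w ∈ s, 0 < y ⬝ᵥ latVec w) :
    ∃ m : Fin n → ℤ, latVec m ⬝ᵥ latVec v = 0 ∧ ∀ w ∈ s, 0 < latVec m ⬝ᵥ latVec w := by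
  have hvv : 0 < latVec v ⬝ᵥ latVec v := by
    refine lt_of_le_of_ne (Finset.sum_nonneg fun i _ => mul_self_nonneg _) fun h => hv0 ?_
    exact latVec_injective ((dotProduct_self_eq_zero.1 h.symm).trans latVec_zero.symm)
  -- project the lattice points `⌊N y⌋` to the hyperplane `v ^ ⊥`
  let g : (Fin n → ℝ) → (Fin n → ℝ) := fun z =>
    (latVec v ⬝ᵥ latVec v) • z - (z ⬝ᵥ latVec v) • latVec v
  have hg : Continuous g := by
    unfold g dotProduct
    fun_prop
  have hgs : ∀ (c : ℝ) z, g (c • z) = c • g z := fun c z => by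
    simp only [g, smul_dotProduct, smul_sub, smul_smul, smul_eq_mul]
    rw [mul_comm c (latVec v ⬝ᵥ latVec v)]
  have hev : ∀ᶠ N : ℕ in atTop, ∀ w ∈ s,
      0 < g ((N : ℝ)⁻¹ • latVec fun i => ⌊y i * N⌋) ⬝ᵥ latVec w := by
    rw [Filter.eventually_all_finset]
    intro w hw
    have hc : Continuous fun z => g z ⬝ᵥ latVec w := by
      unfold dotProduct
      fun_prop
    have := (hc.tendsto y).comp (tendsto_latVec_floor y tendsto_natCast_atTop_atTop)
    refine this.eventually (lt_mem_nhds ?_)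
    simp only [g, hv, zero_smul, sub_zero, smul_dotProduct]
    exact mul_pos hvv (hs w hw)
  obtain ⟨N, hN, hN0⟩ := (hev.and (eventually_gt_atTop 0)).exists
  have hN' : (0 : ℝ) < N := Nat.cast_pos.2 hN0
  set z : Fin n → ℤ := fun i => ⌊y i * N⌋
  refine ⟨(v ⬝ᵥ v) • z - (z ⬝ᵥ v) • v, ?_, fun w hw => ?_⟩
  · simp only [latVec_sub, latVec_zsmul, sub_dotProduct, smul_dotProduct, latVec_dotProduct,
      smul_eq_mul]
    ring
  · have := hN w hw
    rw [hgs, smul_dotProduct, smul_eq_mul] at this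
    have := pos_of_mul_pos_right this (inv_nonneg.2 hN'.le)
    simpa only [g, latVec_sub, latVec_zsmul, latVec_dotProduct] using this

/-- Each member of an irredundant set of generators of a strongly convex cone spans a face. -/
lemma hull_singleton_isFace {n : ℕ} {s : Finset (Fin n → ℤ)} {v : Fin n → ℤ} (hv : v ∈ s)
    (hirr : ∀ w ∈ s, latVec w ∉ PointedCone.hull ℝ (latVec '' (s.erase w : Set (Fin n → ℤ))))
    (hσ : ∀ x ∈ PointedCone.hull ℝ (latVec '' (s : Set (Fin n → ℤ))),
      -x ∈ PointedCone.hull ℝ (latVec '' (s : Set (Fin n → ℤ))) → x = 0) :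
    IsFace (PointedCone.hull ℝ {latVec v})
      (PointedCone.hull ℝ (latVec '' (s : Set (Fin n → ℤ)))) := by
  classical
  have hne : ∀ w ∈ s, w ≠ 0 := fun w hw h => hirr w hw (by rw [h, latVec_zero]; exact zero_mem _)
  have hins : latVec '' (s : Set (Fin n → ℤ)) =
      insert (latVec v) (latVec '' (s.erase v : Set (Fin n → ℤ))) := by
    rw [← Set.image_insert_eq, ← Finset.coe_insert, Finset.insert_erase hv]
  have himg : (((s.erase v).image latVec : Finset (Fin n → ℝ)) : Set (Fin n → ℝ)) =
      latVec '' (s.erase v : Set (Fin n → ℤ)) := Finset.coe_image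
  obtain ⟨f, hf0, hf⟩ := exists_dual_of_irredundant (t := (s.erase v).image latVec)
    (v := latVec v) (by
      simp only [Finset.mem_image, not_exists, not_and]
      exact fun w hw h => hne w (Finset.mem_of_mem_erase hw)
        (latVec_injective (h.trans latVec_zero.symm))) (by rw [himg]; exact hirr v hv)
      (by rw [himg, ← hins]; exact hσ)
  rw [eq_dotProduct f, dotProduct_comm] at hf0
  obtain ⟨m, hm0, hm⟩ := exists_lattice_dual hf0 (hne v hv) (s := s.erase v) fun w hw => by
    rw [dotProduct_comm, ← eq_dotProduct]
    exact hf _ (Finset.mem_image_of_mem _ hw)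
  have key : ∀ x ∈ PointedCone.hull ℝ (latVec '' (s.erase v : Set (Fin n → ℤ))),
      0 ≤ latVec m ⬝ᵥ x ∧ (latVec m ⬝ᵥ x = 0 → x = 0) := by
    intro x hx
    induction hx using Submodule.span_induction with
    | mem x hx =>
      obtain ⟨w, hw, rfl⟩ := hx
      exact ⟨(hm w hw).le, fun h => absurd h (hm w hw).ne'⟩
    | zero => simp
    | add x y _ _ hx hy =>
      rw [dotProduct_add]
      refine ⟨add_nonneg hx.1 hy.1, fun h => ?_⟩
      rw [hx.2 (by linarith [hx.1, hy.1]), hy.2 (by linarith [hx.1, hy.1]), add_zero]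
    | smul a x _ hx =>
      change 0 ≤ _ ⬝ᵥ ((a : ℝ) • x) ∧ (_ ⬝ᵥ ((a : ℝ) • x) = 0 → (a : ℝ) • x = 0)
      rw [dotProduct_smul, smul_eq_mul]
      refine ⟨mul_nonneg a.2 hx.1, fun h => ?_⟩
      rcases mul_eq_zero.1 h with h | h
      · rw [h, zero_smul]
      · rw [hx.2 h, smul_zero]
  have hdec : ∀ x ∈ PointedCone.hull ℝ (latVec '' (s : Set (Fin n → ℤ))), ∃ c : ℝ, 0 ≤ c ∧
      ∃ y ∈ PointedCone.hull ℝ (latVec '' (s.erase v : Set (Fin n → ℤ))),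
        x = c • latVec v + y := by
    intro x hx
    rw [hins] at hx
    obtain ⟨c, y, hy, rfl⟩ := Submodule.mem_span_insert.1 hx
    exact ⟨c, c.2, y, hy, rfl⟩
  refine ⟨m, fun x hx => ?_, fun x => ⟨fun hx => ?_, fun ⟨hx, hx0⟩ => ?_⟩⟩
  · obtain ⟨c, hc, y, hy, rfl⟩ := hdec x hx
    rw [dotProduct_add, dotProduct_smul, hm0, smul_zero, zero_add]
    exact (key y hy).1
  · refine ⟨Submodule.span_mono (Set.singleton_subset_iff.2 (Set.mem_image_of_mem _ hv)) hx, ?_⟩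
    obtain ⟨c, rfl⟩ := Submodule.mem_span_singleton.1 hx
    change _ ⬝ᵥ ((c : ℝ) • latVec v) = 0
    rw [dotProduct_smul, hm0, smul_zero]
  · obtain ⟨c, hc, y, hy, rfl⟩ := hdec x hx
    rw [dotProduct_add, dotProduct_smul, hm0, smul_zero, zero_add] at hx0
    rw [(key y hy).2 hx0, add_zero]
    exact PointedCone.smul_mem _ hc (PointedCone.subset_hull rfl)

lemma exists_irredundant {n : ℕ} (s : Finset (Fin n → ℤ)) : ∃ t : Finset (Fin n → ℤ),
    PointedCone.hull ℝ (latVec '' (t : Set (Fin n → ℤ))) =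
      PointedCone.hull ℝ (latVec '' (s : Set (Fin n → ℤ))) ∧
    ∀ w ∈ t, latVec w ∉ PointedCone.hull ℝ (latVec '' (t.erase w : Set (Fin n → ℤ))) := by
  classical
  induction s using Finset.strongInduction with
  | H s ih =>
    by_cases h : ∀ w ∈ s, latVec w ∉ PointedCone.hull ℝ (latVec '' (s.erase w : Set (Fin n → ℤ)))
    · exact ⟨s, rfl, h⟩
    · push Not at h
      obtain ⟨w, hw, hmem⟩ := h
      obtain ⟨t, ht, hirr⟩ := ih _ (Finset.erase_ssubset hw)
      refine ⟨t, ht.trans ?_, hirr⟩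
      have hins : latVec '' (s : Set (Fin n → ℤ)) =
          insert (latVec w) (latVec '' (s.erase w : Set (Fin n → ℤ))) := by
        rw [← Set.image_insert_eq, ← Finset.coe_insert, Finset.insert_erase hw]
      rw [hins]
      exact (Submodule.span_insert_eq_span hmem).symm

lemma exists_primitive {n : ℕ} {v : Fin n → ℤ} (hv : v ≠ 0) : ∃ (k : ℕ) (w : Fin n → ℤ),
    0 < k ∧ v = k • w ∧ ∀ d : ℤ, (∀ i, d ∣ w i) → IsUnit d := by
  classical
  have hne : ∃ i ∈ (Finset.univ : Finset (Fin n)), v i ≠ 0 := by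
    by_contra! h
    exact hv (funext fun i => h i (Finset.mem_univ i))
  obtain ⟨i, hi, hvi⟩ := hne
  obtain ⟨w, hw, hg⟩ := Finset.extract_gcd v (s := Finset.univ) ⟨i, hi⟩
  have hg0 : Finset.univ.gcd v ≠ 0 := fun h => hvi (Finset.gcd_eq_zero_iff.1 h i hi)
  have hgnn : 0 ≤ Finset.univ.gcd v := by
    rw [← Finset.normalize_gcd (f := v)]
    exact Int.nonneg_of_normalize_eq_self (normalize_idem _)
  refine ⟨(Finset.univ.gcd v).toNat, w, by omega, ?_, fun d hd => ?_⟩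
  · ext i
    rw [hw i (Finset.mem_univ i), Pi.smul_apply, nsmul_eq_mul]
    congr 1
    simp [hgnn]
  · have := Finset.dvd_gcd (s := Finset.univ) (f := w) (fun i _ => hd i)
    rw [hg] at this
    exact isUnit_of_dvd_one this

/-- The cones of a fan are generated by the primitive generators of their rays. -/
lemma Fan.le_hull_rays {n : ℕ} (Δ : Fan n) {σ : PointedCone ℝ (Fin n → ℝ)} (hσ : σ ∈ Δ.cones) :
    σ ≤ PointedCone.hull ℝ (latVec '' {v | v ∈ Δ.rays ∧ latVec v ∈ σ}) := by
  obtain ⟨s, hs⟩ := Δ.rational σ hσ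
  obtain ⟨t, ht, hirr⟩ := exists_irredundant s
  rw [← ht] at hs
  have hsc := Δ.strongly_convex σ hσ
  have hface := Δ.face_mem σ hσ
  intro x hx
  rw [hs] at hx
  revert hx
  change x ∈ PointedCone.hull ℝ _ → _
  intro hx
  refine Submodule.span_le.2 ?_ hx
  rintro _ ⟨v, hv, rfl⟩
  have hv0 : v ≠ 0 := fun h => hirr v hv (by rw [h, latVec_zero]; exact zero_mem _)
  obtain ⟨k, w, hk, rfl, hw⟩ := exists_primitive hv0
  have hk' : (0 : ℝ) < k := Nat.cast_pos.2 hk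
  have hmem : latVec (k • w) ∈ σ := hs ▸ PointedCone.subset_hull ⟨_, hv, rfl⟩
  have heq : PointedCone.hull ℝ {latVec w} = PointedCone.hull ℝ {latVec (k • w)} := by
    apply le_antisymm
    · refine Submodule.span_le.2 (Set.singleton_subset_iff.2 ?_)
      have : latVec w = (k : ℝ)⁻¹ • latVec (k • w) := by
        rw [latVec_nsmul, smul_smul, inv_mul_cancel₀ hk'.ne', one_smul]
      rw [this]
      exact PointedCone.smul_mem _ (inv_nonneg.2 hk'.le) (PointedCone.subset_hull rfl)
    · refine Submodule.span_le.2 (Set.singleton_subset_iff.2 ?_)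
      rw [latVec_nsmul]
      exact PointedCone.smul_mem _ hk'.le (PointedCone.subset_hull rfl)
  have hwσ : latVec w ∈ σ := by
    have := PointedCone.smul_mem _ (inv_nonneg.2 hk'.le) hmem
    rwa [latVec_nsmul, smul_smul, inv_mul_cancel₀ hk'.ne', one_smul] at this
  have hray : w ∈ Δ.rays := by
    refine ⟨hw, heq ▸ hface _ ?_⟩
    rw [hs]
    exact hull_singleton_isFace hv hirr (hs ▸ hsc)
  change latVec (k • w) ∈ PointedCone.hull ℝ _
  rw [latVec_nsmul]
  exact PointedCone.smul_mem _ hk'.le (PointedCone.subset_hull ⟨w, ⟨hray, hwσ⟩, rfl⟩)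

/-! ### The polytope of a globally generated divisor -/

section Polytope

variable {n : ℕ} {Δ : Fan n} {D : Δ.TDivisor}

/-- The cone over `P_D`, cut out by the homogenized inequalities `⟨u, v⟩ ≥ - t a_v`, `t ≥ 0`. -/
def homogenizedPolytope (D : Δ.TDivisor) : Set ((Fin n → ℝ) × ℝ) :=
  {z | 0 ≤ z.2 ∧ ∀ v : Δ.rays, -(D v : ℝ) * z.2 ≤ z.1 ⬝ᵥ latVec v}

lemma exists_bound_dotProduct (hΔ : Δ.IsComplete) (D : Δ.TDivisor) (y : Fin n → ℝ) :
    ∃ B : ℝ, ∀ z ∈ homogenizedPolytope D, -B * z.2 ≤ z.1 ⬝ᵥ y := by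
  obtain ⟨σ, hσ, hy⟩ := hΔ y
  replace hy := Δ.le_hull_rays hσ hy
  induction hy using Submodule.span_induction with
  | mem x hx =>
    obtain ⟨v, ⟨hv, -⟩, rfl⟩ := hx
    exact ⟨D ⟨v, hv⟩, fun z hz => hz.2 ⟨v, hv⟩⟩
  | zero => exact ⟨0, by simp⟩
  | add x y _ _ hx hy =>
    obtain ⟨B, hB⟩ := hx
    obtain ⟨B', hB'⟩ := hy
    refine ⟨B + B', fun z hz => ?_⟩
    rw [dotProduct_add]
    linarith [hB z hz, hB' z hz]
  | smul a x _ hx =>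
    obtain ⟨B, hB⟩ := hx
    refine ⟨a * B, fun z hz => ?_⟩
    change _ ≤ _ ⬝ᵥ ((a : ℝ) • x)
    rw [dotProduct_smul, smul_eq_mul]
    nlinarith [mul_le_mul_of_nonneg_left (hB z hz) a.2]

/-- As the fan is complete, the slices of the cone are bounded. -/
lemma exists_bound (hΔ : Δ.IsComplete) (D : Δ.TDivisor) :
    ∃ B : ℝ, ∀ z ∈ homogenizedPolytope D, ∀ i, |z.1 i| ≤ B * z.2 := by
  have h : ∀ i : Fin n, ∃ B : ℝ, ∀ z ∈ homogenizedPolytope D, |z.1 i| ≤ B * z.2 := by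
    intro i
    obtain ⟨B, hB⟩ := exists_bound_dotProduct hΔ D (Pi.single i 1)
    obtain ⟨B', hB'⟩ := exists_bound_dotProduct hΔ D (-Pi.single i 1)
    refine ⟨max B B', fun z hz => abs_le.2 ⟨?_, ?_⟩⟩
    · have := hB z hz
      rw [dotProduct_single_one] at this
      nlinarith [mul_le_mul_of_nonneg_right (le_max_left B B') hz.1]
    · have := hB' z hz
      rw [dotProduct_neg, dotProduct_single_one] at this
      nlinarith [mul_le_mul_of_nonneg_right (le_max_right B B') hz.1]
  choose B hB using h
  refine ⟨∑ i, |B i|, fun z hz i => (hB i z hz).trans ?_⟩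
  exact mul_le_mul_of_nonneg_right ((le_abs_self _).trans
    (Finset.single_le_sum (f := fun i => |B i|) (fun i _ => abs_nonneg _) (Finset.mem_univ i))) hz.1

lemma mem_polytope_iff {y : Fin n → ℝ} :
    y ∈ polytope D ↔ (y, (1 : ℝ)) ∈ homogenizedPolytope D := by
  simp [polytope, homogenizedPolytope]

lemma smul_mem_homogenizedPolytope {c : ℝ} (hc : 0 ≤ c) {z : (Fin n → ℝ) × ℝ}
    (hz : z ∈ homogenizedPolytope D) : c • z ∈ homogenizedPolytope D := by
  refine ⟨mul_nonneg hc hz.1, fun v => ?_⟩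
  have := mul_le_mul_of_nonneg_left (hz.2 v) hc
  rw [Prod.smul_snd, Prod.smul_fst, smul_dotProduct, smul_eq_mul, smul_eq_mul]
  linarith

lemma add_mem_homogenizedPolytope {z w : (Fin n → ℝ) × ℝ}
    (hz : z ∈ homogenizedPolytope D) (hw : w ∈ homogenizedPolytope D) :
    z + w ∈ homogenizedPolytope D := by
  refine ⟨add_nonneg hz.1 hw.1, fun v => ?_⟩
  rw [Prod.snd_add, Prod.fst_add, add_dotProduct]
  linarith [hz.2 v, hw.2 v]

lemma fst_eq_zero_of_snd_eq_zero (hΔ : Δ.IsComplete) {z : (Fin n → ℝ) × ℝ}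
    (hz : z ∈ homogenizedPolytope D) (h0 : z.2 = 0) : z.1 = 0 := by
  obtain ⟨B, hB⟩ := exists_bound hΔ D
  ext i
  have := hB z hz i
  rw [h0, mul_zero] at this
  exact abs_nonpos_iff.1 this

lemma coe_polytopeCone (hΔ : Δ.IsComplete) :
    (polytopeCone D : Set ((Fin n → ℝ) × ℝ)) = homogenizedPolytope D := by
  ext z
  constructor
  · intro hz
    induction (show z ∈ polytopeCone D from hz) using Submodule.span_induction with
    | mem x hx =>
      obtain ⟨h1, h2⟩ := hx
      obtain ⟨y, t⟩ := x
      obtain rfl : t = 1 := h2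
      exact mem_polytope_iff.1 h1
    | zero => exact ⟨le_rfl, by simp⟩
    | add x y hx' hy' hx hy => exact add_mem_homogenizedPolytope (hx hx') (hy hy')
    | smul a x hx' hx => exact smul_mem_homogenizedPolytope a.2 (hx hx')
  · intro hz
    rcases hz.1.eq_or_lt with h0 | h0
    · have : z = 0 := Prod.ext (fst_eq_zero_of_snd_eq_zero hΔ hz h0.symm) h0.symm
      rw [this]
      exact zero_mem (polytopeCone D)
    · have h1 := smul_mem_homogenizedPolytope (inv_nonneg.2 h0.le) hz
      have h2 : z.2⁻¹ • z = (z.2⁻¹ • z.1, (1 : ℝ)) :=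
        Prod.ext rfl (inv_mul_cancel₀ h0.ne')
      rw [h2] at h1
      have h3 := PointedCone.smul_mem (polytopeCone D) h0.le
        (PointedCone.subset_hull
        (show (z.2⁻¹ • z.1, (1 : ℝ)) ∈ polytope D ×ˢ {1} from ⟨mem_polytope_iff.2 h1, rfl⟩))
      change z.2 • (z.2⁻¹ • z.1, (1 : ℝ)) ∈ polytopeCone D at h3
      rwa [← h2, smul_smul, mul_inv_cancel₀ h0.ne', one_smul] at h3

lemma mem_polytopeCone (hΔ : Δ.IsComplete) {z : (Fin n → ℝ) × ℝ} :
    z ∈ polytopeCone D ↔ z ∈ homogenizedPolytope D := by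
  rw [← coe_polytopeCone hΔ, SetLike.mem_coe]

lemma isClosed_homogenizedPolytope : IsClosed (homogenizedPolytope D) := by
  have : homogenizedPolytope D = {z | 0 ≤ z.2} ∩
      ⋂ v : Δ.rays, {z | -(D v : ℝ) * z.2 ≤ z.1 ⬝ᵥ latVec v} := by
    ext z
    simp [homogenizedPolytope]
  rw [this]
  refine (isClosed_le continuous_const continuous_snd).inter (isClosed_iInter fun v => ?_)
  refine isClosed_le (by fun_prop) ?_
  unfold dotProduct
  fun_prop

lemma finite_latVec_abs_le {n : ℕ} (B : ℝ) : {m : Fin n → ℤ | ∀ i, |latVec m i| ≤ B}.Finite := by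
  refine (Set.finite_Icc (fun _ => -⌈B⌉) (fun _ => ⌈B⌉)).subset fun m hm => ?_
  constructor <;> intro i <;> have := abs_le.1 ((hm i).trans (Int.le_ceil B)) <;>
    simp only [latVec] at this
  · exact_mod_cast this.1
  · exact_mod_cast this.2

lemma finite_latticePoints (hΔ : Δ.IsComplete) (D : Δ.TDivisor) : (latticePoints D).Finite := by
  obtain ⟨B, hB⟩ := exists_bound hΔ D
  refine (finite_latVec_abs_le B).subset fun u hu i => ?_
  simpa using hB _ (mem_polytope_iff.1 hu) i

/-- For a globally generated divisor on a complete toric variety, `P_D` is a lattice polytope. -/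
lemma polytope_subset_convexHull (hΔ : Δ.IsComplete) (hD : IsGloballyGenerated D) :
    polytope D ⊆ convexHull ℝ (latVec '' latticePoints D) := by
  intro x hx
  by_contra hxn
  -- a functional that separates `x` from the lattice points lies in a cone `σ`, and is minimized on
  -- `P_D` by the lattice point `u` that generates `O(D)` on `U_σ`
  obtain ⟨f, c, hfx, hf⟩ := geometric_hahn_banach_point_closed (convex_convexHull ℝ _)
    (((finite_latticePoints hΔ D).image latVec).isCompact_convexHull (𝕜 := ℝ)).isClosed hxn
  obtain ⟨σ, hσ, hy⟩ := hΔ fun i => f (Pi.single i 1)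
  obtain ⟨u, hu, huv⟩ := hD σ hσ
  have key : ∀ y ∈ PointedCone.hull ℝ (latVec '' {v | v ∈ Δ.rays ∧ latVec v ∈ σ}),
      latVec u ⬝ᵥ y ≤ x ⬝ᵥ y := by
    intro y hy
    induction hy using Submodule.span_induction with
    | mem y hy =>
      obtain ⟨v, ⟨hv, hvσ⟩, rfl⟩ := hy
      rw [huv ⟨v, hv⟩ hvσ]
      exact hx ⟨v, hv⟩
    | zero => simp
    | add y z _ _ hy hz =>
      rw [dotProduct_add, dotProduct_add]
      exact add_le_add hy hz
    | smul a y _ hy =>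
      change _ ⬝ᵥ ((a : ℝ) • y) ≤ _ ⬝ᵥ ((a : ℝ) • y)
      rw [dotProduct_smul, dotProduct_smul]
      exact mul_le_mul_of_nonneg_left hy a.2
  have h1 := key _ (Δ.le_hull_rays hσ hy)
  rw [← eq_dotProduct, ← eq_dotProduct] at h1
  have h2 := hf _ (subset_convexHull ℝ _ ⟨u, hu, rfl⟩)
  linarith

/-! ### The semigroup and its conductor -/

/-- A lattice point of `ℤ ^ n × ℤ`, seen as a real vector. -/
def latVecProd {n : ℕ} (s : (Fin n → ℤ) × ℤ) : (Fin n → ℝ) × ℝ := (latVec s.1, (s.2 : ℝ))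

lemma latVecProd_add (s t : (Fin n → ℤ) × ℤ) : latVecProd (s + t) = latVecProd s + latVecProd t :=
  Prod.ext (latVec_add _ _) (Int.cast_add _ _)

lemma latVecProd_zero : latVecProd (0 : (Fin n → ℤ) × ℤ) = 0 :=
  Prod.ext latVec_zero Int.cast_zero

lemma latVecProd_nsmul (k : ℕ) (s : (Fin n → ℤ) × ℤ) :
    latVecProd (k • s) = (k : ℝ) • latVecProd s :=
  Prod.ext (latVec_nsmul _ _) (by simp [latVecProd])

lemma latVecProd_sub (s t : (Fin n → ℤ) × ℤ) : latVecProd (s - t) = latVecProd s - latVecProd t :=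
  Prod.ext (latVec_sub _ _) (Int.cast_sub _ _)

lemma mem_coordMonoid_of_mem {u : Fin n → ℤ} (hu : u ∈ latticePoints D) :
    (u, (1 : ℤ)) ∈ coordMonoid D := AddSubmonoid.subset_closure ⟨hu, rfl⟩

lemma latVecProd_mem_of_mem_coordMonoid {s : (Fin n → ℤ) × ℤ} (hs : s ∈ coordMonoid D) :
    latVecProd s ∈ homogenizedPolytope D := by
  induction hs using AddSubmonoid.closure_induction with
  | mem s hs =>
    obtain ⟨u, k⟩ := s
    obtain ⟨hu, rfl⟩ : u ∈ latticePoints D ∧ k = 1 := hs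
    have := mem_polytope_iff.1 (show latVec u ∈ polytope D from hu)
    simpa [latVecProd] using this
  | zero => rw [latVecProd_zero]; exact ⟨le_rfl, by simp⟩
  | add s t _ _ hs ht => rw [latVecProd_add]; exact add_mem_homogenizedPolytope hs ht

/-- If the differences of lattice points of `P_D` generate `ℤ ^ n`, then every lattice point is a
difference of elements of the semigroup. -/
lemma exists_sub_of_closure_eq_top {u₀ : Fin n → ℤ} (hu₀ : u₀ ∈ latticePoints D)
    (hgen : AddSubgroup.closure ((fun u => u - u₀) '' latticePoints D) = ⊤)
    (z : (Fin n → ℤ) × ℤ) : ∃ s ∈ coordMonoid D, ∃ t ∈ coordMonoid D, z + t = s := by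
  have hadd : ∀ z w : (Fin n → ℤ) × ℤ, (∃ s ∈ coordMonoid D, ∃ t ∈ coordMonoid D, z + t = s) →
      (∃ s ∈ coordMonoid D, ∃ t ∈ coordMonoid D, w + t = s) →
      ∃ s ∈ coordMonoid D, ∃ t ∈ coordMonoid D, z + w + t = s := by
    rintro z w ⟨s, hs, t, ht, h⟩ ⟨s', hs', t', ht', h'⟩
    refine ⟨s + s', add_mem hs hs', t + t', add_mem ht ht', ?_⟩
    rw [← h, ← h']
    abel
  have hneg : ∀ z : (Fin n → ℤ) × ℤ, (∃ s ∈ coordMonoid D, ∃ t ∈ coordMonoid D, z + t = s) →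
      ∃ s ∈ coordMonoid D, ∃ t ∈ coordMonoid D, -z + t = s := by
    rintro z ⟨s, hs, t, ht, h⟩
    exact ⟨t, ht, s, hs, by rw [← h]; abel⟩
  have h1 : ∀ m : Fin n → ℤ, ∃ s ∈ coordMonoid D, ∃ t ∈ coordMonoid D, (m, (0 : ℤ)) + t = s := by
    intro m
    have hm : m ∈ AddSubgroup.closure ((fun u => u - u₀) '' latticePoints D) :=
      hgen ▸ AddSubgroup.mem_top m
    induction hm using AddSubgroup.closure_induction with
    | mem m hm =>
      obtain ⟨u, hu, rfl⟩ := hm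
      exact ⟨_, mem_coordMonoid_of_mem hu, _, mem_coordMonoid_of_mem hu₀, by simp⟩
    | zero => exact ⟨0, zero_mem _, 0, zero_mem _, by simp⟩
    | add x y _ _ hx hy => simpa using hadd _ _ hx hy
    | neg x _ hx => simpa using hneg _ hx
  have h2 : ∀ k : ℕ, ∃ s ∈ coordMonoid D, ∃ t ∈ coordMonoid D, k • (u₀, (1 : ℤ)) + t = s :=
    fun k => ⟨_, nsmul_mem (mem_coordMonoid_of_mem hu₀) k, 0, zero_mem _, add_zero _⟩
  obtain ⟨m, k⟩ := z
  obtain ⟨j, rfl | rfl⟩ := k.eq_nat_or_neg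
  · have := hadd _ _ (h1 (m - j • u₀)) (h2 j)
    simpa using this
  · have := hadd _ _ (h1 (m + j • u₀)) (hneg _ (h2 j))
    simpa using this

/-- The cone over `P_D` is generated by the `(u, 1)`, `u ∈ P_D ∩ M`. -/
lemma exists_nonneg_combination (hΔ : Δ.IsComplete) (hD : IsGloballyGenerated D)
    {z : (Fin n → ℝ) × ℝ} (hz : z ∈ homogenizedPolytope D) :
    ∃ c : (Fin n → ℤ) → ℝ, (∀ u, 0 ≤ c u) ∧
      z = ∑ u ∈ (finite_latticePoints hΔ D).toFinset, c u • latVecProd (u, (1 : ℤ)) := by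
  classical
  rcases hz.1.eq_or_lt with h0 | h0
  · exact ⟨0, fun _ => le_rfl, by
      simpa using Prod.ext (fst_eq_zero_of_snd_eq_zero hΔ hz h0.symm) h0.symm⟩
  · have h1 := smul_mem_homogenizedPolytope (inv_nonneg.2 h0.le) hz
    have h2 : z.2⁻¹ • z = (z.2⁻¹ • z.1, (1 : ℝ)) := Prod.ext rfl (inv_mul_cancel₀ h0.ne')
    rw [h2] at h1
    have h3 := polytope_subset_convexHull hΔ hD (mem_polytope_iff.2 h1)
    have himg : latVec '' latticePoints D =
        (((finite_latticePoints hΔ D).toFinset.image latVec : Finset (Fin n → ℝ)) :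
          Set (Fin n → ℝ)) := by
      simp
    rw [himg] at h3
    obtain ⟨w, hw0, hw1, hw⟩ := Finset.mem_convexHull'.1 h3
    rw [Finset.sum_image latVec_injective.injOn] at hw1 hw
    refine ⟨fun u => if latVec u ∈ (finite_latticePoints hΔ D).toFinset.image latVec then
      z.2 * w (latVec u) else 0, fun u => ?_, ?_⟩
    · dsimp only
      split_ifs with h
      · exact mul_nonneg h0.le (hw0 _ h)
      · exact le_rfl
    · have h4 : z = z.2 • ∑ u ∈ (finite_latticePoints hΔ D).toFinset,
          w (latVec u) • latVecProd (u, (1 : ℤ)) := by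
        have : ∑ u ∈ (finite_latticePoints hΔ D).toFinset, w (latVec u) • latVecProd (u, (1 : ℤ)) =
            z.2⁻¹ • z := by
          rw [h2]
          refine Prod.ext ?_ ?_
          · rw [Prod.fst_sum, ← hw]
            rfl
          · rw [Prod.snd_sum, ← hw1]
            simp [latVecProd]
        rw [this, smul_smul, mul_inv_cancel₀ h0.ne', one_smul]
      refine h4.trans ?_
      rw [Finset.smul_sum]
      refine Finset.sum_congr rfl fun u hu => ?_
      dsimp only
      rw [if_pos (Finset.mem_image_of_mem _ hu), smul_smul]

/-- The semigroup has a conductor: it contains a translate of all lattice points of the cone. -/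
lemma exists_conductor (hΔ : Δ.IsComplete) (hD : IsGloballyGenerated D) {u₀ : Fin n → ℤ}
    (hu₀ : u₀ ∈ latticePoints D)
    (hgen : AddSubgroup.closure ((fun u => u - u₀) '' latticePoints D) = ⊤) :
    ∃ s₀ : (Fin n → ℤ) × ℤ, ∀ z, latVecProd z ∈ homogenizedPolytope D →
      z + s₀ ∈ coordMonoid D := by
  classical
  set U := (finite_latticePoints hΔ D).toFinset
  -- finitely many lattice points, among them those of the parallelotope `∑ [0, 1) (u, 1)`
  obtain ⟨B, hB⟩ := exists_bound hΔ D
  have hfin : {z : (Fin n → ℤ) × ℤ | latVecProd z ∈ homogenizedPolytope D ∧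
      z.2 ≤ (U.card : ℤ)}.Finite := by
    refine ((finite_latVec_abs_le (|B| * U.card)).prod (Set.finite_Icc 0 (U.card : ℤ))).subset
      fun z hz => ?_
    obtain ⟨hz, hz2⟩ := hz
    have h0 : (0 : ℝ) ≤ z.2 := hz.1
    have h1 : (z.2 : ℝ) ≤ U.card := by exact_mod_cast hz2
    refine ⟨fun i => (hB _ hz i).trans ?_, by exact_mod_cast h0, hz2⟩
    calc B * (z.2 : ℝ) ≤ |B| * z.2 := mul_le_mul_of_nonneg_right (le_abs_self B) h0
      _ ≤ |B| * U.card := mul_le_mul_of_nonneg_left h1 (abs_nonneg B)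
  choose s hs t ht hst using exists_sub_of_closure_eq_top hu₀ hgen
  refine ⟨∑ z ∈ hfin.toFinset, t z, fun z hz => ?_⟩
  obtain ⟨c, hc, hzc⟩ := exists_nonneg_combination hΔ hD hz
  -- `z` is the sum of an element `a` of the semigroup and a lattice point of the parallelotope
  set a : (Fin n → ℤ) × ℤ := ∑ u ∈ U, ⌊c u⌋₊ • (u, (1 : ℤ)) with ha
  have hU : ∀ u ∈ U, u ∈ latticePoints D := fun u hu => (Set.Finite.mem_toFinset _).1 hu
  have ha_mem : a ∈ coordMonoid D :=
    sum_mem fun u hu => nsmul_mem (mem_coordMonoid_of_mem (hU u hu)) _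
  have hsum : ∀ (f : (Fin n → ℤ) → (Fin n → ℤ) × ℤ) (V : Finset (Fin n → ℤ)),
      latVecProd (∑ u ∈ V, f u) = ∑ u ∈ V, latVecProd (f u) := by
    intro f V
    exact map_sum (AddMonoidHom.mk' (latVecProd (n := n)) latVecProd_add) f V
  have hfrac : latVecProd (z - a) =
      ∑ u ∈ U, (c u - ⌊c u⌋₊) • latVecProd (u, (1 : ℤ)) := by
    rw [latVecProd_sub, ha, hsum, hzc, ← Finset.sum_sub_distrib]
    refine Finset.sum_congr rfl fun u _ => ?_
    rw [latVecProd_nsmul, sub_smul]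
  have hmem : z - a ∈ hfin.toFinset := by
    rw [Set.Finite.mem_toFinset]
    constructor
    · rw [hfrac]
      have : ∀ V ⊆ U, ∑ u ∈ V, (c u - ⌊c u⌋₊) • latVecProd (u, (1 : ℤ)) ∈
          homogenizedPolytope D := by
        intro V
        induction V using Finset.induction_on with
        | empty => intro _; exact ⟨le_rfl, by simp⟩
        | insert u V hu ih =>
          intro hV
          rw [Finset.sum_insert hu]
          refine add_mem_homogenizedPolytope (smul_mem_homogenizedPolytope
            (sub_nonneg.2 (Nat.floor_le (hc u))) (latVecProd_mem_of_mem_coordMonoid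
              (mem_coordMonoid_of_mem (hU u (hV (Finset.mem_insert_self _ _))))))
            (ih ((Finset.subset_insert _ _).trans hV))
      exact this U subset_rfl
    · have h2 := congrArg Prod.snd hfrac
      rw [Prod.snd_sum] at h2
      have h3 : (((z - a).2 : ℤ) : ℝ) ≤ U.card := by
        change (latVecProd (z - a)).2 ≤ _
        rw [h2, Finset.card_eq_sum_ones, Nat.cast_sum]
        refine Finset.sum_le_sum fun u _ => ?_
        simp only [latVecProd, Prod.smul_snd, smul_eq_mul, Int.cast_one, mul_one, Nat.cast_one]
        linarith [Nat.lt_floor_add_one (c u)]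
      exact_mod_cast h3
  have hdecomp : z + ∑ w ∈ hfin.toFinset, t w =
      a + s (z - a) + ∑ w ∈ hfin.toFinset.erase (z - a), t w := by
    rw [← Finset.add_sum_erase _ t hmem, ← hst (z - a)]
    abel
  rw [hdecomp]
  exact add_mem (add_mem ha_mem (hs _)) (sum_mem fun w _ => ht w)

end Polytope

/-! ### Monomials outside the Frobenius power -/

lemma exists_sub_generator_mem {n : ℕ} {Δ : Fan n} {D : Δ.TDivisor} {s : (Fin n → ℤ) × ℤ}
    (hs : s ∈ coordMonoid D) (h0 : 0 < s.2) :
    ∃ u ∈ latticePoints D, ∃ d ∈ coordMonoid D, s = d + (u, 1) := by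
  have : s = 0 ∨ ∃ u ∈ latticePoints D, ∃ d ∈ coordMonoid D, s = d + (u, 1) := by
    clear h0
    induction hs using AddSubmonoid.closure_induction with
    | mem s hs => exact Or.inr ⟨s.1, hs.1, 0, zero_mem _, by rw [zero_add, ← hs.2]⟩
    | zero => exact Or.inl rfl
    | add s t hs' ht' hs ht =>
      rcases hs with rfl | ⟨u, hu, d, hd, rfl⟩
      · rwa [zero_add]
      · exact Or.inr ⟨u, hu, d + t, add_mem hd ht', by abel⟩
  rcases this with rfl | h
  · exact absurd h0 (lt_irrefl _)
  · exact h

lemma gradedMaximalIdeal_le {n : ℕ} {Δ : Fan n} (D : Δ.TDivisor) (K : Type u) [Field K] :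
    gradedMaximalIdeal (coordGrading D K) ≤ Ideal.span
      (AddMonoidAlgebra.of' K (coordMonoid D) '' {s | s.1.1 ∈ latticePoints D ∧ s.1.2 = 1}) := by
  refine Ideal.span_le.2 ?_
  rintro f ⟨k, hk, hf⟩
  rw [SetLike.mem_coe, AddMonoidAlgebra.mem_ideal_span_of'_image]
  intro s hs
  obtain ⟨u, hu, d, hd, h⟩ := exists_sub_generator_mem s.2 (hk.trans_eq (hf s hs).symm)
  exact ⟨⟨(u, 1), AddSubmonoid.subset_closure ⟨hu, rfl⟩⟩, ⟨hu, rfl⟩, ⟨d, hd⟩, Subtype.ext h⟩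

/-- In characteristic `p` the Frobenius power is the monomial ideal of the `q`-th powers of the
generators. -/
lemma mem_frobeniusPower_iff {n : ℕ} {Δ : Fan n} (D : Δ.TDivisor) (K : Type u) [Field K] {p : ℕ}
    (hp : p.Prime) [CharP K p] (m : ℕ) (f : coordRing D K) :
    f ∈ frobeniusPower (gradedMaximalIdeal (coordGrading D K)) (p ^ m) ↔
      ∀ s ∈ f.coeff.support, ∃ u ∈ latticePoints D, ∃ d ∈ coordMonoid D,
        s.1 = d + p ^ m • (u, (1 : ℤ)) := by
  have : Fact p.Prime := ⟨hp⟩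
  have : CharP (coordRing D K) p := charP_of_injective_algebraMap (algebraMap K _).injective p
  set J : Ideal (coordRing D K) := Ideal.span (AddMonoidAlgebra.of' K (coordMonoid D) ''
    ((fun s => p ^ m • s) '' {s | s.1.1 ∈ latticePoints D ∧ s.1.2 = 1})) with hJ
  -- the `q`-th power map is a ring homomorphism, so it suffices to look at generators
  have hle : gradedMaximalIdeal (coordGrading D K) ≤ J.comap (iterateFrobenius _ p m) := by
    refine (gradedMaximalIdeal_le D K).trans (Ideal.span_le.2 ?_)
    rintro _ ⟨s, hs, rfl⟩
    rw [SetLike.mem_coe, Ideal.mem_comap, iterateFrobenius_def]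
    refine Ideal.subset_span ⟨p ^ m • s, ⟨s, hs, rfl⟩, ?_⟩
    simp [AddMonoidAlgebra.of', AddMonoidAlgebra.single_pow]
  have hEq : frobeniusPower (gradedMaximalIdeal (coordGrading D K)) (p ^ m) = J := by
    apply le_antisymm
    · refine Ideal.span_le.2 ?_
      rintro _ ⟨g, hg, rfl⟩
      have := hle hg
      rwa [Ideal.mem_comap, iterateFrobenius_def] at this
    · refine Ideal.span_le.2 ?_
      rintro _ ⟨_, ⟨s, hs, rfl⟩, rfl⟩
      refine Ideal.subset_span ⟨AddMonoidAlgebra.of' K _ s, Ideal.subset_span ⟨1, one_pos, ?_⟩, ?_⟩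
      · have := AddMonoidAlgebra.single_mem_gradeBy (fun s : coordMonoid D => s.1.2) s (1 : K)
        rw [hs.2] at this
        exact this
      · simp [AddMonoidAlgebra.of', AddMonoidAlgebra.single_pow]
  rw [hEq, hJ, AddMonoidAlgebra.mem_ideal_span_of'_image]
  refine forall₂_congr fun s _ => ⟨?_, ?_⟩
  · rintro ⟨_, ⟨a, ha, rfl⟩, d, rfl⟩
    refine ⟨a.1.1, ha.1, d, d.2, ?_⟩
    rw [← ha.2]
    rfl
  · rintro ⟨u, hu, d, hd, h⟩
    exact ⟨_, ⟨⟨(u, 1), AddSubmonoid.subset_closure ⟨hu, rfl⟩⟩, ⟨hu, rfl⟩, rfl⟩, ⟨d, hd⟩,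
      Subtype.ext h⟩

/-- The dimension of a graded piece modulo a monomial ideal is the number of monomials of that
degree outside the ideal. -/
lemma finrank_map_gradeBy {K M : Type*} [Field K] [AddCommMonoid M] (deg : M → ℤ) (k : ℤ)
    (J : Ideal (AddMonoidAlgebra K M)) (bad : Set M)
    (hJ : ∀ f, f ∈ J ↔ ∀ m ∈ f.coeff.support, m ∈ bad) :
    Module.finrank K ((AddMonoidAlgebra.gradeBy K deg k).map
      (Ideal.Quotient.mkₐ K J).toLinearMap) = Nat.card {m | deg m = k ∧ m ∉ bad} := by
  classical
  set T := {m | deg m = k ∧ m ∉ bad}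
  let v : T → AddMonoidAlgebra K M := fun t => AddMonoidAlgebra.single t.1 1
  have hv : LinearIndependent K v :=
    LinearIndependent.of_comp (AddMonoidAlgebra.coeffLinearEquiv K).toLinearMap
      ((Finsupp.linearIndependent_single_one K M).comp Subtype.val Subtype.val_injective)
  have hspan : ∀ f ∈ Submodule.span K (Set.range v), ∀ m ∈ f.coeff.support, m ∈ T := by
    intro f hf
    induction hf using Submodule.span_induction with
    | mem f hf =>
      obtain ⟨t, rfl⟩ := hf
      intro m hm
      rw [Finset.mem_singleton.1 (Finsupp.support_single_subset hm)]
      exact t.2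
    | zero => simp
    | add f g _ _ hf hg =>
      intro m hm
      exact (Finset.mem_union.1 (Finsupp.support_add hm)).elim (hf m) (hg m)
    | smul a f _ hf => exact fun m hm => hf m (Finsupp.support_smul hm)
  have hw : LinearIndependent K ((Ideal.Quotient.mkₐ K J).toLinearMap ∘ v) := by
    refine hv.map (Submodule.disjoint_def.2 fun f hf hfJ => ?_)
    have hfJ' : f ∈ J := Ideal.Quotient.eq_zero_iff_mem.1 hfJ
    rw [← AddMonoidAlgebra.coeff_eq_zero, ← Finsupp.support_eq_empty,
      Finset.eq_empty_iff_forall_notMem]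
    exact fun m hm => (hspan f hf m hm).2 ((hJ f).1 hfJ' m hm)
  have hEq : (AddMonoidAlgebra.gradeBy K deg k).map (Ideal.Quotient.mkₐ K J).toLinearMap =
      Submodule.span K (Set.range ((Ideal.Quotient.mkₐ K J).toLinearMap ∘ v)) := by
    apply le_antisymm
    · rintro _ ⟨f, hf, rfl⟩
      rw [← AddMonoidAlgebra.sum_coeff_single f, Finsupp.sum, map_sum]
      refine Submodule.sum_mem _ fun m hm => ?_
      by_cases hb : m ∈ bad
      · have : AddMonoidAlgebra.single m (f.coeff m) ∈ J := (hJ _).2 fun m' hm' => by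
          rwa [Finset.mem_singleton.1 (Finsupp.support_single_subset hm')]
        have h0 : (Ideal.Quotient.mkₐ K J).toLinearMap
            (AddMonoidAlgebra.single m (f.coeff m)) = 0 :=
          Ideal.Quotient.eq_zero_iff_mem.2 this
        rw [h0]
        exact zero_mem _
      · have : AddMonoidAlgebra.single m (f.coeff m) = f.coeff m • v ⟨m, hf m hm, hb⟩ := by
          simp [v]
        rw [this, map_smul]
        exact Submodule.smul_mem _ _ (Submodule.subset_span ⟨_, rfl⟩)
    · rw [Submodule.span_le]
      rintro _ ⟨t, rfl⟩
      refine ⟨v t, ?_, rfl⟩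
      have := AddMonoidAlgebra.single_mem_gradeBy deg t.1 (1 : K)
      rwa [t.2.1] at this
  rw [hEq, Module.finrank, rank_span hw, ← Nat.card, Nat.card_range_of_injective hw.injective]

/-- The lattice points `y` with `(y, k)` in the semigroup, but in no translate of it by a multiple
`q (u, 1)` of a generator. -/
def monomialsOutside {n : ℕ} {Δ : Fan n} (D : Δ.TDivisor) (q : ℕ) (k : ℤ) : Set (Fin n → ℤ) :=
  {y | (y, k) ∈ coordMonoid D ∧
    ∀ u ∈ latticePoints D, (y, k) - q • (u, (1 : ℤ)) ∉ coordMonoid D}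

lemma pairApprox_eq {n : ℕ} {Δ : Fan n} (D : Δ.TDivisor) (K : Type u) [Field K] {p : ℕ}
    (hp : p.Prime) [CharP K p] (m : ℕ) (x : ℝ) :
    pairApprox D K p m x =
      (monomialsOutside D (p ^ m) ⌊x * (p : ℝ) ^ m⌋).ncard / ((p : ℝ) ^ m) ^ n := by
  rw [pairApprox, hkApprox, coordGrading, finrank_map_gradeBy (fun s : coordMonoid D => s.1.2) _ _
    {s | ∃ u ∈ latticePoints D, ∃ d ∈ coordMonoid D, s.1 = d + p ^ m • (u, (1 : ℤ))}
    (mem_frobeniusPower_iff D K hp m), Nat.add_sub_cancel, ← Nat.card_coe_set_eq]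
  congr 2
  refine Nat.card_congr ⟨fun s => ⟨s.1.1.1, ?_⟩, fun y => ⟨⟨(y.1, _), y.2.1⟩, rfl, ?_⟩,
    fun s => ?_, fun y => rfl⟩
  · obtain ⟨⟨⟨y, k⟩, hs⟩, hk, hbad⟩ := s
    obtain rfl : k = _ := hk
    exact ⟨hs, fun u hu h => hbad ⟨u, hu, _, h, (sub_add_cancel _ _).symm⟩⟩
  · rintro ⟨u, hu, d, hd, h⟩
    exact y.2.2 u hu (by
      rwa [show (y.1, ⌊x * (p : ℝ) ^ m⌋) = _ from h, add_sub_cancel_right])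
  · obtain ⟨⟨⟨y, k⟩, hs⟩, hk, hbad⟩ := s
    obtain rfl : k = _ := hk
    rfl

/-- A finite set `T` of lattice points has the volume of the `a⁻¹`-cubes at the points of
`a⁻¹ T`. -/
lemma volume_floor_mem {n : ℕ} {T : Set (Fin n → ℤ)} (hT : T.Finite) {a : ℝ} (ha : 0 < a) :
    volume {y : Fin n → ℝ | (fun i => ⌊y i * a⌋) ∈ T} = ENNReal.ofReal (T.ncard / a ^ n) := by
  classical
  have hset : {y : Fin n → ℝ | (fun i => ⌊y i * a⌋) ∈ T} = ⋃ t ∈ hT.toFinset,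
      Set.univ.pi fun i => Set.Ico ((t i : ℝ) / a) (((t i : ℝ) + 1) / a) := by
    ext y
    simp only [Set.mem_ofPred_eq, Set.mem_iUnion, Set.mem_univ_pi, Set.mem_Ico, div_le_iff₀ ha,
      lt_div_iff₀ ha, ← Int.floor_eq_iff, Set.Finite.mem_toFinset, exists_prop]
    constructor
    · exact fun h => ⟨_, h, fun i => rfl⟩
    · rintro ⟨t, ht, h⟩
      rwa [show (fun i => ⌊y i * a⌋) = t from funext h]
  have hdisj : (hT.toFinset : Set (Fin n → ℤ)).PairwiseDisjoint fun t =>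
      Set.univ.pi fun i => Set.Ico ((t i : ℝ) / a) (((t i : ℝ) + 1) / a) := by
    intro t _ t' _ hne
    rw [Function.onFun, Set.disjoint_left]
    intro y hy hy'
    simp only [Set.mem_univ_pi, Set.mem_Ico, div_le_iff₀ ha, lt_div_iff₀ ha,
      ← Int.floor_eq_iff] at hy hy'
    exact hne (funext fun i => (hy i).symm.trans (hy' i))
  rw [hset, measure_biUnion_finset hdisj
    fun t _ => MeasurableSet.univ_pi fun i => measurableSet_Ico]
  have hcube : ∀ t : Fin n → ℤ, volume (Set.univ.pi fun i =>
      Set.Ico ((t i : ℝ) / a) (((t i : ℝ) + 1) / a)) = ENNReal.ofReal (1 / a ^ n) := by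
    intro t
    rw [Real.volume_pi_Ico]
    simp only [← sub_div, add_sub_cancel_left]
    rw [Finset.prod_const, Finset.card_univ, Fintype.card_fin, ← ENNReal.ofReal_pow (by positivity),
      div_pow, one_pow]
  rw [Finset.sum_congr rfl fun t _ => hcube t, Finset.sum_const, nsmul_eq_mul,
    ← Set.ncard_eq_toFinset_card T hT, ← ENNReal.ofReal_natCast,
    ← ENNReal.ofReal_mul (by positivity), mul_one_div]

/-! ### The limit of the normalized counts -/

section Limit

variable {n : ℕ} {Δ : Fan n} {D : Δ.TDivisor}

lemma convex_slice (D : Δ.TDivisor) (x : ℝ) :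
    Convex ℝ {y : Fin n → ℝ | (y, x) ∈ homogenizedPolytope D} := by
  intro y hy z hz a b ha hb hab
  have := add_mem_homogenizedPolytope (smul_mem_homogenizedPolytope ha hy)
    (smul_mem_homogenizedPolytope hb hz)
  rwa [Prod.smul_mk, Prod.smul_mk, Prod.mk_add_mk, ← add_smul, hab, one_smul] at this

/-- At positive height, interior points of a slice are interior points of the cone. -/
lemma mem_interior_of_mem_interior_slice {x : ℝ} (hx : 0 < x) {y : Fin n → ℝ}
    (hy : y ∈ interior {y : Fin n → ℝ | (y, x) ∈ homogenizedPolytope D}) :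
    (y, x) ∈ interior (homogenizedPolytope D) := by
  rw [mem_interior_iff_mem_nhds]
  have hf : ContinuousAt (fun z : (Fin n → ℝ) × ℝ => (x / z.2) • z.1) (y, x) :=
    (continuousAt_const.div continuousAt_snd hx.ne').smul continuousAt_fst
  have hfy : (fun z : (Fin n → ℝ) × ℝ => (x / z.2) • z.1) (y, x) = y := by
    simp [div_self hx.ne']
  have h1 : ∀ᶠ z in 𝓝 (y, x), (x / z.2) • z.1 ∈
      interior {y : Fin n → ℝ | (y, x) ∈ homogenizedPolytope D} :=
    hf.eventually (by rw [hfy]; exact isOpen_interior.mem_nhds hy)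
  have h2 : ∀ᶠ z : (Fin n → ℝ) × ℝ in 𝓝 (y, x), 0 < z.2 :=
    continuousAt_snd.eventually (lt_mem_nhds hx)
  filter_upwards [h1, h2] with z hz1 hz2
  have hz3 : ((x / z.2) • z.1, x) ∈ homogenizedPolytope D :=
    interior_subset (s := {y : Fin n → ℝ | (y, x) ∈ homogenizedPolytope D}) hz1
  have := smul_mem_homogenizedPolytope (div_nonneg hz2.le hx.le) hz3
  rw [Prod.smul_mk, smul_smul, div_mul_div_cancel₀ hx.ne', div_self hz2.ne', one_smul, smul_eq_mul,
    div_mul_cancel₀ _ hx.ne'] at this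
  exact this

/-- Every horizontal slice of the boundary of the cone is negligible. -/
lemma volume_slice_frontier (hn : 1 ≤ n) (hΔ : Δ.IsComplete) (D : Δ.TDivisor) (x : ℝ) :
    volume {y : Fin n → ℝ | (y, x) ∈ frontier (homogenizedPolytope D)} = 0 := by
  have hcl := isClosed_homogenizedPolytope (D := D)
  rcases lt_trichotomy x 0 with hx | rfl | hx
  · refine measure_mono_null (t := ∅) (fun y hy => ?_) measure_empty
    exact absurd (hcl.frontier_subset hy).1 (not_le.2 hx)
  · -- the slice at height `0` is the origin, a null set as `n ≥ 1`
    have : Nonempty (Fin n) := ⟨⟨0, hn⟩⟩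
    refine measure_mono_null (t := {0}) (fun y hy => ?_) (measure_singleton _)
    exact fst_eq_zero_of_snd_eq_zero hΔ (hcl.frontier_subset hy) rfl
  · refine measure_mono_null (fun y hy => ?_) ((convex_slice D x).addHaar_frontier volume)
    rw [hcl.frontier_eq] at hy
    exact ⟨subset_closure hy.1, fun h => hy.2 (mem_interior_of_mem_interior_slice hx h)⟩

/-- Off the boundary of the cone, membership in the semigroup is asymptotically membership in the
cone. -/
lemma eventually_mem_coordMonoid_iff {s₀ : (Fin n → ℤ) × ℤ}
    (hs₀ : ∀ z, latVecProd z ∈ homogenizedPolytope D → z + s₀ ∈ coordMonoid D)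
    {a : ℕ → ℝ} (ha : Tendsto a atTop atTop) {w : ℕ → (Fin n → ℤ) × ℤ} {z : (Fin n → ℝ) × ℝ}
    (hw : Tendsto (fun m => (a m)⁻¹ • latVecProd (w m)) atTop (𝓝 z))
    (hz : z ∉ frontier (homogenizedPolytope D)) :
    ∀ᶠ m in atTop, (w m ∈ coordMonoid D ↔ z ∈ homogenizedPolytope D) := by
  have hcl := isClosed_homogenizedPolytope (D := D)
  by_cases hzC : z ∈ homogenizedPolytope D
  · have hint : z ∈ interior (homogenizedPolytope D) := by
      by_contra h
      exact hz (hcl.frontier_eq ▸ ⟨hzC, h⟩)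
    -- the shift by the conductor `s₀` is negligible after rescaling
    have h1 : Tendsto (fun m => (a m)⁻¹ • latVecProd (w m - s₀)) atTop (𝓝 z) := by
      have := hw.sub ((tendsto_inv_atTop_zero.comp ha).smul_const (latVecProd s₀))
      rw [zero_smul, sub_zero] at this
      refine this.congr fun m => ?_
      rw [latVecProd_sub, smul_sub]
      rfl
    filter_upwards [h1.eventually (isOpen_interior.mem_nhds hint), ha.eventually_gt_atTop 0]
      with m hm ham
    have h2 := smul_mem_homogenizedPolytope ham.le (interior_subset hm)
    rw [smul_smul, mul_inv_cancel₀ ham.ne', one_smul] at h2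
    simpa [hzC] using hs₀ _ h2
  · filter_upwards [hw.eventually (hcl.isOpen_compl.mem_nhds hzC), ha.eventually_gt_atTop 0]
      with m hm ham
    simp only [hzC, iff_false]
    exact fun h => hm (smul_mem_homogenizedPolytope (inv_nonneg.2 ham.le)
      (latVecProd_mem_of_mem_coordMonoid h))

lemma mem_region_iff (hΔ : Δ.IsComplete) {z : (Fin n → ℝ) × ℝ} : z ∈ region D ↔
    z ∈ homogenizedPolytope D ∧
      ∀ u ∈ latticePoints D, z - (latVec u, (1 : ℝ)) ∉ homogenizedPolytope D := by
  simp only [region, Set.mem_ofPred_eq, mem_polytopeCone hΔ]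

lemma closure_region_subset (hΔ : Δ.IsComplete) :
    closure (region D) ⊆ homogenizedPolytope D :=
  closure_minimal (fun _ hz => ((mem_region_iff hΔ).1 hz).1) isClosed_homogenizedPolytope

/-- Off the boundaries of the translates of the cone, the region agrees with its closure. -/
lemma mem_closure_region_iff (hΔ : Δ.IsComplete) {z : (Fin n → ℝ) × ℝ}
    (hz : ∀ u : Fin n → ℤ, z - (latVec u, (1 : ℝ)) ∉ frontier (homogenizedPolytope D)) :
    z ∈ closure (region D) ↔ z ∈ region D := by
  refine ⟨fun h => (mem_region_iff hΔ).2 ⟨closure_region_subset hΔ h, fun u hu hzu => ?_⟩,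
    fun h => subset_closure h⟩
  have hint : z - (latVec u, (1 : ℝ)) ∈ interior (homogenizedPolytope D) := by
    by_contra h
    exact hz u (isClosed_homogenizedPolytope.frontier_eq ▸ ⟨hzu, h⟩)
  have hcont : Continuous fun z : (Fin n → ℝ) × ℝ => z - (latVec u, (1 : ℝ)) := by fun_prop
  obtain ⟨z', hz', hreg⟩ := mem_closure_iff.1 h _ (isOpen_interior.preimage hcont) hint
  exact ((mem_region_iff hΔ).1 hreg).2 u hu (interior_subset hz')

lemma eventually_mem_monomialsOutside_iff (hΔ : Δ.IsComplete) {s₀ : (Fin n → ℤ) × ℤ}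
    (hs₀ : ∀ z, latVecProd z ∈ homogenizedPolytope D → z + s₀ ∈ coordMonoid D)
    {q : ℕ → ℕ} (hq : Tendsto (fun m => (q m : ℝ)) atTop atTop) {y : Fin n → ℝ} {x : ℝ}
    (h0 : (y, x) ∉ frontier (homogenizedPolytope D))
    (hu : ∀ u : Fin n → ℤ, (y, x) - (latVec u, (1 : ℝ)) ∉ frontier (homogenizedPolytope D)) :
    ∀ᶠ m in atTop, ((fun i => ⌊y i * q m⌋) ∈ monomialsOutside D (q m) ⌊x * q m⌋ ↔
      (y, x) ∈ closure (region D)) := by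
  have hlim : Tendsto (fun m => (q m : ℝ)⁻¹ •
      latVecProd ((fun i => ⌊y i * q m⌋), ⌊x * q m⌋)) atTop (𝓝 (y, x)) := by
    refine (tendsto_latVec_floor y hq).prodMk_nhds ((tendsto_floor_mul_div x hq).congr fun m => ?_)
    rw [div_eq_inv_mul]
    rfl
  have h1 := eventually_mem_coordMonoid_iff hs₀ hq hlim h0
  have h2 : ∀ᶠ m in atTop, ∀ u ∈ latticePoints D,
      ((((fun i => ⌊y i * q m⌋), ⌊x * q m⌋) - q m • (u, (1 : ℤ)) ∈ coordMonoid D) ↔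
        (y, x) - (latVec u, (1 : ℝ)) ∈ homogenizedPolytope D) := by
    rw [Filter.eventually_all_finite (finite_latticePoints hΔ D)]
    intro u _
    refine eventually_mem_coordMonoid_iff hs₀ hq ?_ (hu u)
    refine (hlim.sub_const (latVec u, (1 : ℝ))).congr' ?_
    filter_upwards [hq.eventually_gt_atTop 0] with m hm
    rw [latVecProd_sub, latVecProd_nsmul, smul_sub, smul_smul, inv_mul_cancel₀ hm.ne', one_smul]
    simp [latVecProd]
  filter_upwards [h1, h2] with m hm1 hm2
  rw [mem_closure_region_iff hΔ hu, mem_region_iff hΔ, monomialsOutside, Set.mem_ofPred_eq, hm1]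
  exact and_congr_right fun _ => forall₂_congr fun u hu => not_congr (hm2 u hu)

lemma ae_notMem_frontier (hn : 1 ≤ n) (hΔ : Δ.IsComplete) (D : Δ.TDivisor) (x : ℝ) :
    ∀ᵐ y : Fin n → ℝ, (y, x) ∉ frontier (homogenizedPolytope D) ∧
      ∀ u : Fin n → ℤ, (y, x) - (latVec u, (1 : ℝ)) ∉ frontier (homogenizedPolytope D) := by
  rw [eventually_and, ae_all_iff]
  refine ⟨?_, fun u => ?_⟩
  · rw [ae_iff]
    simpa using volume_slice_frontier hn hΔ D x
  · rw [ae_iff]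
    have h := (measurePreserving_sub_right (volume : Measure (Fin n → ℝ))
      (latVec u)).quasiMeasurePreserving.preimage_null (volume_slice_frontier hn hΔ D (x - 1))
    simpa using h

/-- The lattice points counted lie in a box. -/
lemma abs_le_of_mem_monomialsOutside {B : ℝ}
    (hB : ∀ z ∈ homogenizedPolytope D, ∀ i, |z.1 i| ≤ B * z.2) {q : ℕ} {x : ℝ}
    {y : Fin n → ℤ} (hy : y ∈ monomialsOutside D q ⌊x * q⌋) (i : Fin n) :
    |latVec y i| ≤ |B| * |x| * q := by
  have h := latVecProd_mem_of_mem_coordMonoid hy.1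
  have h0 : (0 : ℝ) ≤ ⌊x * q⌋ := h.1
  have h1 : (⌊x * q⌋ : ℝ) ≤ |x| * q := (Int.floor_le _).trans
    (mul_le_mul_of_nonneg_right (le_abs_self x) (Nat.cast_nonneg q))
  calc |latVec y i| ≤ B * ⌊x * q⌋ := hB _ h i
    _ ≤ |B| * ⌊x * q⌋ := mul_le_mul_of_nonneg_right (le_abs_self B) h0
    _ ≤ |B| * (|x| * q) := mul_le_mul_of_nonneg_left h1 (abs_nonneg B)
    _ = _ := by ring

lemma volume_closure_region_ne_top (hΔ : Δ.IsComplete) (D : Δ.TDivisor) (x : ℝ) :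
    volume {y : Fin n → ℝ | (y, x) ∈ closure (region D)} ≠ ⊤ := by
  obtain ⟨B, hB⟩ := exists_bound hΔ D
  refine ne_top_of_le_ne_top (isCompact_Icc (a := fun _ : Fin n => -(B * x))
    (b := fun _ => B * x)).measure_ne_top (measure_mono fun y hy => ?_)
  have := hB _ (closure_region_subset hΔ hy)
  exact ⟨fun i => (abs_le.1 (this i)).1, fun i => (abs_le.1 (this i)).2⟩

/-- After rescaling by `q`, the lattice points outside the Frobenius power become the volume of the
slice: the points are replaced by cubes, and the indicator functions of the resulting bounded sets
converge almost everywhere. -/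
theorem tendsto_ncard_monomialsOutside (hn : 1 ≤ n) (hΔ : Δ.IsComplete) {s₀ : (Fin n → ℤ) × ℤ}
    (hs₀ : ∀ z, latVecProd z ∈ homogenizedPolytope D → z + s₀ ∈ coordMonoid D)
    {q : ℕ → ℕ} (hq : Tendsto (fun m => (q m : ℝ)) atTop atTop) (hq1 : ∀ m, 1 ≤ q m) (x : ℝ) :
    Tendsto (fun m => ((monomialsOutside D (q m) ⌊x * q m⌋).ncard : ℝ) / (q m : ℝ) ^ n) atTop
      (𝓝 (volume {y : Fin n → ℝ | (y, x) ∈ closure (region D)}).toReal) := by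
  obtain ⟨B, hB⟩ := exists_bound hΔ D
  have hfin : ∀ m, (monomialsOutside D (q m) ⌊x * q m⌋).Finite := fun m =>
    (finite_latVec_abs_le (|B| * |x| * q m)).subset fun y hy i =>
      abs_le_of_mem_monomialsOutside hB hy i
  have hpos : ∀ m, (0 : ℝ) < q m := fun m => Nat.cast_pos.2 (hq1 m)
  have hconv : Tendsto (fun m => volume {y : Fin n → ℝ | (fun i => ⌊y i * (q m : ℝ)⌋) ∈
      monomialsOutside D (q m) ⌊x * q m⌋}) atTop
      (𝓝 (volume {y : Fin n → ℝ | (y, x) ∈ closure (region D)})) := by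
    refine tendsto_measure_of_ae_tendsto_indicator atTop
      (isClosed_closure.preimage (Continuous.prodMk_left x)).measurableSet (fun m => ?_)
      (B := Set.Icc (fun _ => -(|B| * |x| + 1)) (fun _ => |B| * |x| + 1)) measurableSet_Icc
      isCompact_Icc.measure_ne_top (Eventually.of_forall fun m y hy => ?_) ?_
    · have hmeas : Measurable fun (y : Fin n → ℝ) i => ⌊y i * (q m : ℝ)⌋ :=
        measurable_pi_lambda _ fun i => ((measurable_pi_apply i).mul_const _).floor
      exact hmeas (Set.to_countable _).measurableSet
    · have hb := fun i => abs_le.1 (abs_le_of_mem_monomialsOutside hB hy i)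
      have h1 : (1 : ℝ) ≤ q m := by exact_mod_cast hq1 m
      refine ⟨fun i => ?_, fun i => ?_⟩
      · have h2 := Int.floor_le (y i * (q m : ℝ))
        have h3 := (hb i).1
        simp only [latVec] at h3
        refine le_of_mul_le_mul_right ?_ (hpos m)
        linarith
      · have h2 := Int.lt_floor_add_one (y i * (q m : ℝ))
        have h3 := (hb i).2
        simp only [latVec] at h3
        refine le_of_mul_le_mul_right ?_ (hpos m)
        linarith
    · filter_upwards [ae_notMem_frontier hn hΔ D x] with y hy
      exact eventually_mem_monomialsOutside_iff hΔ hs₀ hq hy.1 hy.2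
  refine ((ENNReal.tendsto_toReal (volume_closure_region_ne_top hΔ D x)).comp hconv).congr
    fun m => ?_
  rw [Function.comp_apply, volume_floor_mem (hfin m) (hpos m), ENNReal.toReal_ofReal]
  positivity

end Limit

end Toric

theorem theorem1p1 {n : ℕ} (hn : 1 ≤ n) {p : ℕ} (hp : p.Prime)
    (K : Type*) [Field K] [IsAlgClosed K] [CharP K p]
    (Δ : Toric.Fan n) (hΔ : Δ.IsComplete) (D : Δ.TDivisor) (hD : Toric.IsVeryAmple D K)
    (x : ℝ) (hx : 0 ≤ x) :
    Filter.Tendsto (fun m => Toric.pairApprox D K p m x) Filter.atTop (nhds (Toric.HKd D K p x)) ∧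
      MeasureTheory.volume {y : Fin n → ℝ | (y, x) ∈ closure (Toric.region D)} ≠ ⊤ ∧
      Toric.HKd D K p x =
        (MeasureTheory.volume {y : Fin n → ℝ | (y, x) ∈ closure (Toric.region D)}).toReal := by
  obtain ⟨hne, hmono⟩ := Toric.mono_torusMap_of_isVeryAmple hD
  obtain ⟨u₀, hu₀⟩ := id hne
  obtain ⟨s₀, hs₀⟩ := Toric.exists_conductor hΔ hD.1 hu₀
    (Toric.closure_latticePoints_sub (K := K) hne u₀)
  have hq : Filter.Tendsto (fun m : ℕ => ((p ^ m : ℕ) : ℝ)) Filter.atTop Filter.atTop :=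
    tendsto_natCast_atTop_atTop.comp (tendsto_pow_atTop_atTop_of_one_lt hp.one_lt)
  have hlim : Filter.Tendsto (fun m => Toric.pairApprox D K p m x) Filter.atTop
      (nhds (MeasureTheory.volume {y : Fin n → ℝ | (y, x) ∈ closure (Toric.region D)}).toReal) := by
    refine (Toric.tendsto_ncard_monomialsOutside hn hΔ hs₀ hq
      (fun m => Nat.one_le_pow _ _ hp.pos) x).congr fun m => ?_
    rw [Toric.pairApprox_eq D K hp, Nat.cast_pow]
  have hHK : Toric.HKd D K p x =
      (MeasureTheory.volume {y : Fin n → ℝ | (y, x) ∈ closure (Toric.region D)}).toReal :=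
    hlim.limUnder_eq
  exact ⟨hHK ▸ hlim, Toric.volume_closure_region_ne_top hΔ D x, hHK⟩
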